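/- Let $M$ be a complete simply connected surface of constant curvature $\chi$ (for $\chi=1$, the unit sphere), and let $P\subset M$ be a convex geodesic polygon with at least three corners, all interior angles being less than $\pi$; if $\chi=1$, $P$ lies in an open hemisphere. Consider the billiard in $P$. An $n$-segment billiard orbit is a sequence of $n$ consecutive directed chords $x_1,\dots,x_n$ of $P$, where each $x_{i+1}$ begins at the end of $x_i$, which is not a corner, and is obtained from $x_i$ by geodesic reflection in the side containing this point; chords running along a side are not considered. The orbit is regular if none of its chords begins or ends in a corner. Let the side complexity $F(n)$ be the number of words $s_1\cdots s_{n+1}$ in the sides of $P$ such that some regular $n$-segment orbit begins on $s_1$, and then hits $s_2,\dots,s_{n+1}$ in this order. A generalized diagonal with $n$ segments is an $n$-segment billiard orbit which begins and ends in corners and contains no corner in its interior. A family of generalized diagonals is an injective, continuously differentiable one-parameter family of generalized diagonals with $n$ segments; families are counted as maximal ones, and a generalized diagonal is isolated if it lies in no family. For $k\ge 3$ let $gd(k)$ be the number of isolated generalized diagonals with $k$ segments and $fgd(k)$ the number of (maximal) families of generalized diagonals with $k$ segments, and set $$GD(n)=\sum_{3\le k\le n} gd(k),\qquad FGD(n)=\sum_{3\le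 k\le n} fgd(k).$$ Then the following holds. 1. If $\chi=1$, then $gd(k)$ and $fgd(k)$ are finite for all $k\ge3$, and there are integers $c_1,c_2$ depending only on $P$ such that for all $n\ge1$ $$F(n)=c_1+c_2n+\sum_{3\le k\le n}GD(k)-\sum_{3\le k\le n}FGD(k).$$ 2. If $\chi\le0$, then $gd(k)$ is finite for all $k\ge3$, and there are integers $c_1,c_2$ depending only on $P$ such that for all $n\ge1$ $$F(n)=c_1+c_2n+\sum_{3\le k\le n}GD(k).$$ -/

import Mathlib

open scoped Matrix

noncomputable section

namespace Billiard

/-- The complete simply connected surface of constant curvature `κ`, as a surface in `ℝ³`: the sheet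
`x₀² + κ (x₁² + x₂²) = 1` (with `0 < x₀` if `κ ≤ 0`), with the Riemannian metric induced by
`κ⁻¹ dx₀² + dx₁² + dx₂²` (by `dx₁² + dx₂²` if `κ = 0`). It is the unit sphere for `κ = 1`, the
Euclidean plane `x₀ = 1` for `κ = 0`, and the hyperboloid model of the hyperbolic plane for
`κ = -1`. Its complete geodesics are its nonempty intersections with planes through the origin. -/
def Surface (κ : ℝ) : Set (Fin 3 → ℝ) :=
  {x | x 0 ^ 2 + κ * (x 1 ^ 2 + x 2 ^ 2) = 1 ∧ (κ ≤ 0 → 0 < x 0)}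

/-- The complete geodesic through two distinct (and, on the sphere, not antipodal) points. -/
def geodLine (κ : ℝ) (x y : Fin 3 → ℝ) : Set (Fin 3 → ℝ) :=
  {z | z ∈ Surface κ ∧ ∃ s t : ℝ, z = s • x + t • y}

/-- The shortest geodesic segment joining two points (not antipodal ones, on the sphere). -/
def geodSegment (κ : ℝ) (x y : Fin 3 → ℝ) : Set (Fin 3 → ℝ) :=
  {z | z ∈ Surface κ ∧ ∃ s t : ℝ, 0 ≤ s ∧ 0 ≤ t ∧ z = s • x + t • y}

/-- The geodesic reflection of the surface about the geodesic through `v` and `w`: this geodesic is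
the zero set of the linear form `ℓ = v × w`, and `(κ ℓ₀, ℓ₁, ℓ₂)` is a vector normal to it. -/
def geodReflection (κ : ℝ) (v w x : Fin 3 → ℝ) : Fin 3 → ℝ :=
  let l := v ⨯₃ w
  x - (2 * (l ⬝ᵥ x) / (κ * l 0 ^ 2 + l 1 ^ 2 + l 2 ^ 2)) • ![κ * l 0, l 1, l 2]

/-- A convex geodesic polygon with `p ≥ 3` corners `v₀, …, v_{p-1}` on the surface of curvature `κ`,
listed in cyclic (counterclockwise) order: all the other corners lie strictly on the left of the
geodesic through `v_i` and `v_{i+1}` (indices mod `p`). For `κ = 1` this forces all the corners to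
lie in one open hemisphere. -/
structure ConvexPolygon (κ : ℝ) (p : ℕ) [NeZero p] where
  three_le : 3 ≤ p
  corner : Fin p → (Fin 3 → ℝ)
  corner_mem : ∀ i, corner i ∈ Surface κ
  convex : ∀ i j, j ≠ i → j ≠ i + 1 → 0 < (corner i ⨯₃ corner (i + 1)) ⬝ᵥ corner j

namespace ConvexPolygon

variable {κ : ℝ} {p : ℕ} [NeZero p] (P : ConvexPolygon κ p)

/-- The points of the (closed) polygon. -/
def region : Set (Fin 3 → ℝ) :=
  {x | x ∈ Surface κ ∧ ∀ i, 0 ≤ (P.corner i ⨯₃ P.corner (i + 1)) ⬝ᵥ x}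

/-- The `i`-th (closed) side of the polygon. -/
def side (i : Fin p) : Set (Fin 3 → ℝ) :=
  geodSegment κ (P.corner i) (P.corner (i + 1))

/-- The interior points of the `i`-th side. -/
def openSide (i : Fin p) : Set (Fin 3 → ℝ) :=
  P.side i \ {P.corner i, P.corner (i + 1)}

/-- The boundary of the polygon. -/
def boundary : Set (Fin 3 → ℝ) := ⋃ i, P.side i

/-- The geodesic reflection about the `i`-th side. -/
def sideReflection (i : Fin p) : (Fin 3 → ℝ) → (Fin 3 → ℝ) :=
  geodReflection κ (P.corner i) (P.corner (i + 1))

/-- The phase points of the billiard: the directed geodesic segments `[b, e]` inside the polygon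
with both endpoints on its boundary. Segments running along a side are left out. -/
def IsChord (b e : Fin 3 → ℝ) : Prop :=
  b ∈ P.boundary ∧ e ∈ P.boundary ∧ geodSegment κ b e ⊆ P.region ∧
    ∀ i, ¬ geodSegment κ b e ⊆ P.side i

/-- The billiard map sends the chord `[b, e]` to the chord `[e, e']`: the point `e` is interior to a
side, and the geodesic carrying `[e, e']` is the reflection about this side of the geodesic carrying
`[b, e]`. (As the polygon is convex, there is exactly one such chord `[e, e']`.) -/
def BilliardStep (b e e' : Fin 3 → ℝ) : Prop :=
  P.IsChord b e ∧ P.IsChord e e' ∧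
    ∃ i, e ∈ P.openSide i ∧ geodLine κ e e' = P.sideReflection i '' geodLine κ b e

/-- The sequence of points `q₀, q₁, …, qₙ` is an `n`-segment billiard orbit, with the consecutive
segments `[q₀, q₁], [q₁, q₂], …, [qₙ₋₁, qₙ]`. -/
def IsOrbit (n : ℕ) (q : Fin (n + 1) → (Fin 3 → ℝ)) : Prop :=
  (∀ i : Fin n, P.IsChord (q i.castSucc) (q i.succ)) ∧
    ∀ (i : ℕ) (h : i + 2 < n + 1),
      P.BilliardStep (q ⟨i, by omega⟩) (q ⟨i + 1, by omega⟩) (q ⟨i + 2, h⟩)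

/-- The words `s₀ s₁ … sₙ` in the sides that code the regular `n`-segment billiard orbits
`q₀, …, qₙ`, i.e. those for which each `qᵢ` is an interior point of a side, namely of `sᵢ`. -/
def sideWords (n : ℕ) : Set (Fin (n + 1) → Fin p) :=
  {s | ∃ q, P.IsOrbit n q ∧ ∀ i, q i ∈ P.openSide (s i)}

/-- The side complexity `F(n)`. -/
def sideComplexity (n : ℕ) : ℕ := (P.sideWords n).ncard

/-- An `n`-segment generalized diagonal: an `n`-segment billiard orbit that begins and ends in
corners and has no corners in its interior. (The points `q₁, …, qₙ₋₁` of an orbit are not corners,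
and the interior of a chord of a convex polygon contains no corner.) -/
def IsGenDiag (n : ℕ) (q : Fin (n + 1) → (Fin 3 → ℝ)) : Prop :=
  P.IsOrbit n q ∧ q 0 ∈ Set.range P.corner ∧ q (Fin.last n) ∈ Set.range P.corner

/-- A family of `n`-segment generalized diagonals: the image of an injective continuously
differentiable one-parameter family. -/
def IsGenDiagFamily (n : ℕ) (S : Set (Fin (n + 1) → (Fin 3 → ℝ))) : Prop :=
  ∃ γ : ℝ → (Fin (n + 1) → (Fin 3 → ℝ)),
    ContDiffOn ℝ 1 γ (Set.Ioo 0 1) ∧ Set.InjOn γ (Set.Ioo 0 1) ∧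
      (∀ t ∈ Set.Ioo (0 : ℝ) 1, P.IsGenDiag n (γ t)) ∧ S = γ '' Set.Ioo 0 1

/-- The isolated `n`-segment generalized diagonals: those which lie in no family. -/
def isolatedGenDiags (n : ℕ) : Set (Fin (n + 1) → (Fin 3 → ℝ)) :=
  {q | P.IsGenDiag n q ∧ ∀ S, P.IsGenDiagFamily n S → q ∉ S}

/-- The maximal families of `n`-segment generalized diagonals. -/
def genDiagFamilies (n : ℕ) : Set (Set (Fin (n + 1) → (Fin 3 → ℝ))) :=
  {S | Maximal (P.IsGenDiagFamily n) S}

/-- The number of isolated generalized diagonals with at least `3` and at most `n` segments. -/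
def GD (n : ℕ) : ℕ := ∑ k ∈ Finset.Icc 3 n, (P.isolatedGenDiags k).ncard

/-- The number of (maximal) families of generalized diagonals with at least `3` and at most `n`
segments. -/
def FGD (n : ℕ) : ℕ := ∑ k ∈ Finset.Icc 3 n, (P.genDiagFamilies k).ncard

end ConvexPolygon

end Billiard

end

open scoped Matrix

noncomputable section

namespace Billiard

/-! A directed chord from $b$ to $e$ is recorded by the linear form $b\times e$ on $\mathbb R^3$, up
to a positive factor. Along the side where the chord begins this form passes from positive to
negative, along the side where it ends from negative to positive. Passing to the next chord applies
minus the side reflection, a linear map on forms (`cross_sideReflection`, `geodLine_eq_image_iff`).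
Hence the regular orbits with a word $w$ correspond to the rays of an open convex cone, `cell w`,
and $F(n)$ counts the words with nonempty cone (`isOrbit_iff`, `sideWords_eq_cellWords`).

The second difference of $F$ is computed separately for each middle word $w$, from the extensions
$aw$, $wb$ and $awb$. The engine is `sum_down_eq`: on a convex set of forms which all cross one
fixed side upwards, the number of sides crossed downwards by some form is one more than the number
of corners met by some form, provided that no corner is met without a change of sign.
`bilateral_count` applies this twice: to the forward extensions on the cell of each $aw$, and to the
backward extensions on the slice of forms in `cell w` whose forward continuation hits a given corner
$b$. Each pair of corners $(a,b)$ joined by a generalized diagonal through $w$ then contributes $1$,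
unless every form whose continuation hits $b$ also comes from $a$. In that case the slice is
degenerate and the contribution is $-1$.

The degenerate case means that the unfolded end corners lie on one line through the origin
(`Conjugate`). If they do not, two independent linear conditions determine the ray, so the word
carries at most one diagonal, which is then isolated (`diagSet_subsingleton`). If they do, the
diagonals with this word form an open interval (`isGenDiagFamily_diagSet`). It is a maximal family,
because a continuous family cannot change its word. So the second difference of $F$ is the number of
isolated diagonals minus the number of families, and two summations give the formula. For
$\kappa\le0$ a geodesic does not return to its starting point, so conjugate end corners do not occur
(`not_conjugate_of_nonpos`). -/

open Classical in
/-- The integer indicator of a proposition. -/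
def ind (a : Prop) : ℤ := if a then 1 else 0

lemma ind_true {a : Prop} (h : a) : ind a = 1 := if_pos h

lemma ind_false {a : Prop} (h : ¬ a) : ind a = 0 := if_neg h

lemma ind_congr {a b : Prop} (h : a ↔ b) : ind a = ind b := by rw [propext h]

lemma ncard_eq_sum_ind {α : Type*} [Fintype α] (S : Set α) : (S.ncard : ℤ) = ∑ a, ind (a ∈ S) := by
  classical
  rw [Set.ncard_eq_toFinset_card', ← Set.filter_mem_univ_eq_toFinset, Finset.card_filter]
  push_cast
  exact Finset.sum_congr rfl fun a _ => by simp [ind]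

/-- Four vectors of $\mathbb R^3$ satisfy the linear relation with determinant coefficients given by
Cramer's rule. This is $f$ applied to that relation. -/
lemma triple_form_identity (f a b c d : Fin 3 → ℝ) :
    (f ⬝ᵥ a) * ((c ⨯₃ d) ⬝ᵥ b) - (f ⬝ᵥ b) * ((c ⨯₃ d) ⬝ᵥ a) + (f ⬝ᵥ c) * ((a ⨯₃ b) ⬝ᵥ d)
      - (f ⬝ᵥ d) * ((a ⨯₃ b) ⬝ᵥ c) = 0 := by
  simp [dotProduct, Fin.sum_univ_three, cross_apply]
  ring

/-- Two forms with vanishing cross product are proportional. -/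
lemma smul_eq_smul_of_cross_eq_zero {l m : Fin 3 → ℝ} (h : l ⨯₃ m = 0) (u : Fin 3 → ℝ) :
    (l ⬝ᵥ u) • m = (m ⬝ᵥ u) • l := by
  have h0 := congrFun h 0
  have h1 := congrFun h 1
  have h2 := congrFun h 2
  simp [cross_apply] at h0 h1 h2
  ext i
  fin_cases i <;> simp [dotProduct, Fin.sum_univ_three]
  · linear_combination (-u 1) * h2 + u 2 * h1
  · linear_combination u 0 * h2 - u 2 * h0
  · linear_combination (-u 0) * h1 + u 1 * h0

/-! ### Sign changes of a linear form around a convex polygon -/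

namespace ConvexPolygon

variable {κ : ℝ} {p : ℕ} [NeZero p] (P : ConvexPolygon κ p)

/-- The linear form vanishing on the `i`-th side and positive at the other corners. -/
def sideForm (i : Fin p) : Fin 3 → ℝ := P.corner i ⨯₃ P.corner (i + 1)

include P in
lemma add_one_ne (i : Fin p) : i + 1 ≠ i := by
  have h3 := P.three_le
  intro h
  have h' : (1 : Fin p) = 0 := by simpa using h
  have := congrArg Fin.val h'
  simp at this
  omega

include P in
lemma add_two_ne (i : Fin p) : i + 1 + 1 ≠ i := by
  have h3 := P.three_le
  intro h
  have h' : (1 : Fin p) + 1 = 0 := by simpa [add_assoc] using h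
  have := congrArg Fin.val h'
  rw [Fin.val_add, Fin.val_one', Nat.mod_eq_of_lt (by omega : 1 < p),
    Nat.mod_eq_of_lt (by omega : 1 + 1 < p)] at this
  simp at this

lemma sideForm_corner_self (i : Fin p) : P.sideForm i ⬝ᵥ P.corner i = 0 := by
  simp only [sideForm, dotProduct_comm _ (P.corner i), dot_self_cross]

lemma sideForm_corner_succ (i : Fin p) : P.sideForm i ⬝ᵥ P.corner (i + 1) = 0 := by
  simp only [sideForm, dotProduct_comm _ (P.corner (i + 1)), dot_cross_self]

lemma sideForm_corner_pos {i j : Fin p} (h : j ≠ i) (h' : j ≠ i + 1) :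
    0 < P.sideForm i ⬝ᵥ P.corner j := P.convex i j h h'

lemma sideForm_corner_nonneg (i j : Fin p) : 0 ≤ P.sideForm i ⬝ᵥ P.corner j := by
  by_cases h : j = i
  · rw [h, sideForm_corner_self]
  by_cases h' : j = i + 1
  · rw [h', sideForm_corner_succ]
  exact (P.sideForm_corner_pos h h').le

lemma eq_or_eq_of_sideForm_corner {i j : Fin p} (h : P.sideForm i ⬝ᵥ P.corner j = 0) :
    j = i ∨ j = i + 1 := by
  by_contra! hc
  exact (P.sideForm_corner_pos hc.1 hc.2).ne' h

/-- For distinct sides, one of the two corners of one of them is off the other one. -/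
lemma sideForm_corner_add_pos {i j : Fin p} (h : i ≠ j) :
    0 < P.sideForm j ⬝ᵥ P.corner i ∨ 0 < P.sideForm j ⬝ᵥ P.corner (i + 1) := by
  by_contra! hc
  have h1 := P.eq_or_eq_of_sideForm_corner (le_antisymm hc.1 (P.sideForm_corner_nonneg j i))
  have h2 := P.eq_or_eq_of_sideForm_corner (le_antisymm hc.2 (P.sideForm_corner_nonneg j (i + 1)))
  rcases h1 with h1 | h1
  · exact h h1
  · rcases h2 with h2 | h2
    · rw [h1] at h2
      exact P.add_two_ne j h2
    · exact h (by simpa using h2)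

lemma corner_identity (f : Fin 3 → ℝ) (i j : Fin p) :
    (f ⬝ᵥ P.corner i) * (P.sideForm j ⬝ᵥ P.corner (i + 1))
      - (f ⬝ᵥ P.corner (i + 1)) * (P.sideForm j ⬝ᵥ P.corner i)
      + (f ⬝ᵥ P.corner j) * (P.sideForm i ⬝ᵥ P.corner (j + 1))
      - (f ⬝ᵥ P.corner (j + 1)) * (P.sideForm i ⬝ᵥ P.corner j) = 0 :=
  triple_form_identity _ _ _ _ _

/-- A linear form changes its sign from negative to positive at most once around the polygon. -/
lemma form_neg_succ {f : Fin 3 → ℝ} {i j : Fin p} (hi : f ⬝ᵥ P.corner i < 0)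
    (hi' : 0 < f ⬝ᵥ P.corner (i + 1)) (hij : j ≠ i) (hj : f ⬝ᵥ P.corner j ≤ 0) :
    f ⬝ᵥ P.corner (j + 1) < 0 := by
  by_contra! hj'
  have h := P.corner_identity f i j
  -- Under the assumed signs no term of the identity is positive. One of the first two is negative,
  -- because side $i$ has a corner off side $j$.
  have a1 := P.sideForm_corner_nonneg j i
  have a2 := P.sideForm_corner_nonneg j (i + 1)
  have a3 := mul_nonpos_of_nonpos_of_nonneg hj (P.sideForm_corner_nonneg i (j + 1))
  have a4 := mul_nonneg hj' (P.sideForm_corner_nonneg i j)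
  rcases P.sideForm_corner_add_pos hij.symm with h1 | h1
  · nlinarith [mul_pos hi' h1]
  · nlinarith [mul_pos_of_neg_of_neg hi (neg_lt_zero.2 h1)]

/-- The form `f` crosses the `i`-th side, from positive to negative. -/
def Down (i : Fin p) (f : Fin 3 → ℝ) : Prop :=
  0 < f ⬝ᵥ P.corner i ∧ f ⬝ᵥ P.corner (i + 1) < 0

/-- The form `f` crosses the `i`-th side, possibly at its first corner. -/
def Half (i : Fin p) (f : Fin 3 → ℝ) : Prop :=
  0 ≤ f ⬝ᵥ P.corner i ∧ f ⬝ᵥ P.corner (i + 1) < 0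

lemma Down.half {P : ConvexPolygon κ p} {i : Fin p} {f : Fin 3 → ℝ} (h : P.Down i f) :
    P.Half i f := ⟨h.1.le, h.2⟩

/-- For two half-crossings all four terms of `corner_identity` are nonnegative, so all vanish. This
makes each of the two sides begin on the other one, and two distinct sides cannot each follow the
other when there are at least three. -/
lemma Half.unique {P : ConvexPolygon κ p} {i j : Fin p} {f : Fin 3 → ℝ} (hi : P.Half i f)
    (hj : P.Half j f) : i = j := by
  by_contra hij
  have h := P.corner_identity f i j
  have a1 := mul_nonneg hi.1 (P.sideForm_corner_nonneg j (i + 1))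
  have a2 := mul_nonneg hj.1 (P.sideForm_corner_nonneg i (j + 1))
  have b1 := P.sideForm_corner_nonneg j i
  have b2 := P.sideForm_corner_nonneg i j
  have c1 := mul_nonneg (neg_nonneg.2 hi.2.le) b1
  have c2 := mul_nonneg (neg_nonneg.2 hj.2.le) b2
  have e1 : P.sideForm j ⬝ᵥ P.corner i = 0 := by
    by_contra hne
    nlinarith [mul_pos (neg_pos.2 hi.2) (lt_of_le_of_ne b1 (Ne.symm hne))]
  have e2 : P.sideForm i ⬝ᵥ P.corner j = 0 := by
    by_contra hne
    nlinarith [mul_pos (neg_pos.2 hj.2) (lt_of_le_of_ne b2 (Ne.symm hne))]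
  rcases P.eq_or_eq_of_sideForm_corner e1 with h1 | h1
  · exact hij h1
  rcases P.eq_or_eq_of_sideForm_corner e2 with h2 | h2
  · exact hij h2.symm
  rw [h1] at h2
  exact P.add_two_ne j h2.symm

/-- On a convex set of forms which all cross the `i`-th side upwards, the number of sides that are
crossed downwards exceeds the number of corners that are met by one. -/
lemma sum_down_eq {D : Set (Fin 3 → ℝ)} (hD : Convex ℝ D) (hne : D.Nonempty)
    (F : (Fin 3 → ℝ) →ₗ[ℝ] (Fin 3 → ℝ)) (i : Fin p)
    (hup : ∀ x ∈ D, F x ⬝ᵥ P.corner i < 0 ∧ 0 < F x ⬝ᵥ P.corner (i + 1))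
    (hnd : ∀ j, ∀ x ∈ D, F x ⬝ᵥ P.corner j = 0 →
      (∃ y ∈ D, 0 < F y ⬝ᵥ P.corner j) ∧ ∃ y ∈ D, F y ⬝ᵥ P.corner j < 0) :
    ∑ j, ind (∃ x ∈ D, P.Down j (F x)) = 1 + ∑ j, ind (∃ x ∈ D, F x ⬝ᵥ P.corner j = 0) := by
  set N : Fin p → ℤ := fun j => ind (∃ x ∈ D, F x ⬝ᵥ P.corner j < 0) with hN
  -- Summed around the polygon, the differences of `N` cancel, and only the correction at the upward
  -- side $i$ remains.
  have key : ∀ j, ind (∃ x ∈ D, P.Down j (F x)) - ind (∃ x ∈ D, F x ⬝ᵥ P.corner j = 0)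
      = (N (j + 1) - N j) + if j = i then 1 else 0 := by
    intro j
    by_cases hj : j = i
    · subst hj
      obtain ⟨x, hx⟩ := hne
      have e1 : N j = 1 := ind_true ⟨x, hx, (hup x hx).1⟩
      have e2 : N (j + 1) = 0 := by
        apply ind_false
        rintro ⟨y, hy, hy'⟩
        exact absurd (hup y hy).2 hy'.not_gt
      rw [ind_false, ind_false, e1, e2]
      · simp
      · rintro ⟨y, hy, hy'⟩
        exact absurd hy' (hup y hy).1.ne
      · rintro ⟨y, hy, hy'⟩
        exact absurd (hup y hy).1 hy'.1.not_gt
    rw [if_neg hj, add_zero]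
    by_cases hNj : ∃ x ∈ D, F x ⬝ᵥ P.corner j < 0
    -- A negative value at corner $j$ persists at the next corner. It remains to see that a downward
    -- crossing of side $j$ and a zero at corner $j$ produce each other: interpolate with $y$ to
    -- obtain a zero, and push a zero towards a positive value to obtain a crossing.
    · obtain ⟨y, hy, hyj⟩ := hNj
      have e1 : N j = 1 := ind_true ⟨y, hy, hyj⟩
      have e2 : N (j + 1) = 1 :=
        ind_true ⟨y, hy, P.form_neg_succ (hup y hy).1 (hup y hy).2 hj hyj.le⟩
      rw [e1, e2, sub_self, sub_eq_zero]
      apply ind_congr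
      constructor
      · rintro ⟨x, hx, hxj, -⟩
        set a := F x ⬝ᵥ P.corner j
        set b := F y ⬝ᵥ P.corner j
        refine ⟨(-b / (a - b)) • x + (a / (a - b)) • y, hD hx hy ?_ ?_ ?_, ?_⟩
        · exact div_nonneg (by linarith) (by linarith)
        · exact div_nonneg (by linarith) (by linarith)
        · rw [← add_div, div_eq_one_iff_eq (by linarith)]
          ring
        · rw [map_add, map_smul, map_smul, add_dotProduct, smul_dotProduct, smul_dotProduct,
            smul_eq_mul, smul_eq_mul]
          change -b / (a - b) * a + a / (a - b) * b = 0
          ring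
      · rintro ⟨x, hx, hxj⟩
        obtain ⟨⟨z, hz, hzj⟩, -⟩ := hnd j x hx hxj
        have hx1 := P.form_neg_succ (hup x hx).1 (hup x hx).2 hj hxj.le
        set a := F x ⬝ᵥ P.corner (j + 1)
        set b := F z ⬝ᵥ P.corner (j + 1)
        have hpos : 0 < 1 + |b| - a := by have := abs_nonneg b; linarith
        -- The push is small enough for the value at corner $j+1$, namely
        -- $(1-e)a+eb=a(1+|b|-b)/(1+|b|-a)$, to stay negative.
        set e := (-a) / (1 + |b| - a) with he
        have he0 : 0 < e := div_pos (by linarith) hpos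
        have he1 : 1 - e = (1 + |b|) / (1 + |b| - a) := by
          rw [he]; field_simp; ring
        refine ⟨(1 - e) • x + e • z, hD hx hz ?_ he0.le (by ring), ?_, ?_⟩
        · rw [he1]; positivity
        · rw [map_add, map_smul, map_smul, add_dotProduct, smul_dotProduct, smul_dotProduct, hxj]
          simpa using mul_pos he0 hzj
        · rw [map_add, map_smul, map_smul, add_dotProduct, smul_dotProduct, smul_dotProduct,
            smul_eq_mul, smul_eq_mul]
          change (1 - e) * a + e * b < 0
          have : (1 - e) * a + e * b = a * (1 + |b| - b) / (1 + |b| - a) := by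
            rw [he1, he]; ring
          rw [this]
          exact div_neg_of_neg_of_pos
            (mul_neg_of_neg_of_pos hx1 (by linarith [le_abs_self b])) hpos
    -- With no negative value at corner $j$, nondegeneracy excludes zeros as well. All values there
    -- are positive, so crossing side $j$ only requires a negative value at corner $j+1$.
    · have e1 : N j = 0 := ind_false hNj
      rw [e1, ind_false (a := ∃ x ∈ D, F x ⬝ᵥ P.corner j = 0), sub_zero, sub_zero]
      · apply ind_congr
        constructor
        · rintro ⟨x, hx, hxj⟩
          exact ⟨x, hx, hxj.2⟩
        · rintro ⟨x, hx, hxj⟩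
          refine ⟨x, hx, ?_, hxj⟩
          by_contra! hle
          rcases hle.lt_or_eq with h | h
          · exact hNj ⟨x, hx, h⟩
          · exact hNj (hnd j x hx h).2
      · rintro ⟨x, hx, hxj⟩
        exact hNj (hnd j x hx hxj).2
  have hsum := Finset.sum_congr (rfl : (Finset.univ : Finset (Fin p)) = Finset.univ)
    fun j _ => key j
  rw [Finset.sum_sub_distrib, Finset.sum_add_distrib, Finset.sum_sub_distrib,
    Finset.sum_ite_eq' Finset.univ i] at hsum
  have hs := Equiv.sum_comp (Equiv.addRight (1 : Fin p)) N
  simp only [Equiv.coe_addRight] at hs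
  rw [hs] at hsum
  simp at hsum
  linarith

end ConvexPolygon

/-! ### Open convex cells of forms and their two-sided extensions -/

lemma exists_add_sub_smul_mem {C : Set (Fin 3 → ℝ)} (hC : IsOpen C) {x : Fin 3 → ℝ} (hx : x ∈ C)
    (d : Fin 3 → ℝ) : ∃ e : ℝ, 0 < e ∧ x + e • d ∈ C ∧ x + (-e) • d ∈ C := by
  have hc : Continuous fun e : ℝ => x + e • d := by fun_prop
  have h0 : (fun e : ℝ => x + e • d) ⁻¹' C ∈ nhds (0 : ℝ) :=
    (hC.preimage hc).mem_nhds (by simpa using hx)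
  obtain ⟨r, hr, hb⟩ := Metric.mem_nhds_iff.1 h0
  refine ⟨r / 2, by positivity, hb ?_, hb ?_⟩ <;>
    simp [abs_of_pos hr, hr]

/-- A point of an open set at which a linear form vanishes can be moved inside the set, in a
direction in which the form does not vanish, to both sides. -/
lemma exists_pos_neg_of_isOpen {C : Set (Fin 3 → ℝ)} (hC : IsOpen C) {x : Fin 3 → ℝ} (hx : x ∈ C)
    (f : (Fin 3 → ℝ) →ₗ[ℝ] ℝ) (hf : f x = 0) {d : Fin 3 → ℝ} (hd : f d ≠ 0) :
    (∃ e : ℝ, x + e • d ∈ C ∧ 0 < f (x + e • d)) ∧ ∃ e : ℝ, x + e • d ∈ C ∧ f (x + e • d) < 0 := by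
  obtain ⟨e, he, h1, h2⟩ := exists_add_sub_smul_mem hC hx d
  rcases lt_or_gt_of_ne hd with h | h
  · refine ⟨⟨-e, h2, ?_⟩, e, h1, ?_⟩ <;> simp only [map_add, map_smul, hf, smul_eq_mul] <;> nlinarith
  · refine ⟨⟨e, h1, ?_⟩, -e, h2, ?_⟩ <;> simp only [map_add, map_smul, hf, smul_eq_mul] <;> nlinarith

/-- The linear form `x ↦ F x · u`. -/
def dotForm (F : (Fin 3 → ℝ) →ₗ[ℝ] (Fin 3 → ℝ)) (u : Fin 3 → ℝ) : (Fin 3 → ℝ) →ₗ[ℝ] ℝ where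
  toFun x := F x ⬝ᵥ u
  map_add' x y := by rw [map_add, add_dotProduct]
  map_smul' c x := by rw [map_smul, smul_dotProduct]; rfl

lemma continuous_dotForm (F : (Fin 3 → ℝ) →ₗ[ℝ] (Fin 3 → ℝ)) (u : Fin 3 → ℝ) :
    Continuous fun x => F x ⬝ᵥ u := LinearMap.continuous_of_finiteDimensional (dotForm F u)

lemma convex_setOf_dot_pos (F : (Fin 3 → ℝ) →ₗ[ℝ] (Fin 3 → ℝ)) (u : Fin 3 → ℝ) :
    Convex ℝ {x | 0 < F x ⬝ᵥ u} :=
  convex_halfSpace_gt (dotForm F u).isLinear 0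

lemma convex_setOf_dot_neg (F : (Fin 3 → ℝ) →ₗ[ℝ] (Fin 3 → ℝ)) (u : Fin 3 → ℝ) :
    Convex ℝ {x | F x ⬝ᵥ u < 0} :=
  convex_halfSpace_lt (dotForm F u).isLinear 0

lemma convex_setOf_dot_zero (F : (Fin 3 → ℝ) →ₗ[ℝ] (Fin 3 → ℝ)) (u : Fin 3 → ℝ) :
    Convex ℝ {x | F x ⬝ᵥ u = 0} :=
  convex_hyperplane (dotForm F u).isLinear 0

namespace ConvexPolygon

variable {κ : ℝ} {p : ℕ} [NeZero p] (P : ConvexPolygon κ p)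

lemma convex_down (F : (Fin 3 → ℝ) →ₗ[ℝ] (Fin 3 → ℝ)) (i : Fin p) :
    Convex ℝ {x | P.Down i (F x)} :=
  (convex_setOf_dot_pos F _).inter (convex_setOf_dot_neg F _)

lemma isOpen_down (F : (Fin 3 → ℝ) →ₗ[ℝ] (Fin 3 → ℝ)) (i : Fin p) :
    IsOpen {x | P.Down i (F x)} :=
  (isOpen_lt continuous_const (continuous_dotForm F _)).inter
    (isOpen_lt (continuous_dotForm F _) continuous_const)

lemma sum_down_eq_of_isOpen {D : Set (Fin 3 → ℝ)} (hD : Convex ℝ D) (hO : IsOpen D)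
    (F : (Fin 3 → ℝ) →ₗ[ℝ] (Fin 3 → ℝ)) (i : Fin p)
    (hup : ∀ x ∈ D, F x ⬝ᵥ P.corner i < 0 ∧ 0 < F x ⬝ᵥ P.corner (i + 1))
    (hF : ∀ j, ∃ d, F d ⬝ᵥ P.corner j ≠ 0) :
    ∑ j, ind (∃ x ∈ D, P.Down j (F x)) =
      ind D.Nonempty + ∑ j, ind (∃ x ∈ D, F x ⬝ᵥ P.corner j = 0) := by
  by_cases hne : D.Nonempty
  · rw [ind_true hne]
    refine P.sum_down_eq hD hne F i hup fun j x hx hxj => ?_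
    obtain ⟨d, hd⟩ := hF j
    obtain ⟨⟨e, he, he'⟩, e', h, h'⟩ :=
      exists_pos_neg_of_isOpen hO hx (dotForm F (P.corner j)) hxj hd
    exact ⟨⟨_, he, he'⟩, _, h, h'⟩
  · rw [Set.not_nonempty_iff_eq_empty] at hne
    simp [hne, ind]

/-- The bilateral multiplicity of an open convex cell: `F` and `G` describe the lines into which the
elements of the cell are continued backwards and forwards. -/
lemma bilateral_count {C : Set (Fin 3 → ℝ)} (hC : Convex ℝ C) (hO : IsOpen C)
    (F G : (Fin 3 → ℝ) →ₗ[ℝ] (Fin 3 → ℝ)) (i j : Fin p)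
    (hF : ∀ x ∈ C, F x ⬝ᵥ P.corner i < 0 ∧ 0 < F x ⬝ᵥ P.corner (i + 1))
    (hG : ∀ x ∈ C, G x ⬝ᵥ P.corner j < 0 ∧ 0 < G x ⬝ᵥ P.corner (j + 1))
    (hG' : ∀ b, ∃ d, G d ⬝ᵥ P.corner b ≠ 0) :
    ∑ a, ∑ b, ind (∃ x ∈ C, P.Down a (F x) ∧ P.Down b (G x))
      - ∑ a, ind (∃ x ∈ C, P.Down a (F x)) - ∑ b, ind (∃ x ∈ C, P.Down b (G x)) + ind C.Nonempty
    = ∑ a, ∑ b, ind (∃ x ∈ C, F x ⬝ᵥ P.corner a = 0 ∧ G x ⬝ᵥ P.corner b = 0) *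
        (1 - 2 * ind (∀ x, G x ⬝ᵥ P.corner b = 0 → F x ⬝ᵥ P.corner a = 0)) := by
  have row : ∀ a, ∑ b, ind (∃ x ∈ C, P.Down a (F x) ∧ P.Down b (G x)) =
      ind (∃ x ∈ C, P.Down a (F x)) +
        ∑ b, ind (∃ x ∈ C, P.Down a (F x) ∧ G x ⬝ᵥ P.corner b = 0) := by
    intro a
    have h := P.sum_down_eq_of_isOpen (hC.inter (P.convex_down F a)) (hO.inter (P.isOpen_down F a))
      G j (fun x hx => hG x hx.1) hG'
    simpa only [Set.mem_inter_iff, Set.mem_ofPred_eq, and_assoc, Set.Nonempty] using h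
  -- The terms left over in the row count are regrouped by the corner $b$ and counted on the slice
  -- of $C$ whose forward continuation passes through $b$.
  have col : ∀ b, ∑ a, ind (∃ x ∈ C, P.Down a (F x) ∧ G x ⬝ᵥ P.corner b = 0) =
      ind (∃ x ∈ C, G x ⬝ᵥ P.corner b = 0) +
        ∑ a, ind (∃ x ∈ C, F x ⬝ᵥ P.corner a = 0 ∧ G x ⬝ᵥ P.corner b = 0) *
          (1 - 2 * ind (∀ x, G x ⬝ᵥ P.corner b = 0 → F x ⬝ᵥ P.corner a = 0)) := by
    intro b
    by_cases hne : ∃ x ∈ C, G x ⬝ᵥ P.corner b = 0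
    · rw [ind_true hne]
      by_cases hco : ∃ a, ∀ x, G x ⬝ᵥ P.corner b = 0 → F x ⬝ᵥ P.corner a = 0
      · obtain ⟨a, ha⟩ := hco
        have half : ∀ x ∈ C, G x ⬝ᵥ P.corner b = 0 → P.Half a (F x) := by
          intro x hx hb
          have h0 := ha x hb
          refine ⟨h0.ge, P.form_neg_succ (hF x hx).1 (hF x hx).2 ?_ h0.le⟩
          rintro rfl
          exact (hF x hx).1.ne h0
        have l0 : ∀ a', ind (∃ x ∈ C, P.Down a' (F x) ∧ G x ⬝ᵥ P.corner b = 0) = 0 := by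
          intro a'
          apply ind_false
          rintro ⟨x, hx, hd, hb⟩
          obtain rfl := Half.unique hd.half (half x hx hb)
          exact hd.1.ne' (ha x hb)
        -- All backward continuations pass through the corner $a$, so no side is crossed downwards.
        -- The identity becomes $0=1+1\cdot(1-2)$.
        rw [Finset.sum_eq_zero fun a' _ => l0 a', Finset.sum_eq_single a]
        · obtain ⟨x, hx, hb⟩ := hne
          rw [ind_true ⟨x, hx, ha x hb, hb⟩, ind_true ha]
          norm_num
        · intro a' _ haa
          rw [ind_false, zero_mul]
          rintro ⟨x, hx, h0, hb⟩
          refine haa (Half.unique (f := F x) ⟨h0.ge, ?_⟩ (half x hx hb))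
          refine P.form_neg_succ (hF x hx).1 (hF x hx).2 ?_ h0.le
          rintro rfl
          exact (hF x hx).1.ne h0
        · simp
      · have h := P.sum_down_eq (D := C ∩ {x | G x ⬝ᵥ P.corner b = 0})
          (hC.inter (convex_setOf_dot_zero G _)) hne F i (fun x hx => hF x hx.1) ?_
        · simp only [Set.mem_inter_iff, Set.mem_ofPred_eq, and_assoc] at h
          rw [Finset.sum_congr rfl fun a _ => ind_congr (a := ∃ x ∈ C, P.Down a (F x) ∧
            G x ⬝ᵥ P.corner b = 0) (b := ∃ x ∈ C, G x ⬝ᵥ P.corner b = 0 ∧ P.Down a (F x))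
            (by simp only [and_comm]), h]
          congr 1
          refine Finset.sum_congr rfl fun a _ => ?_
          rw [ind_false (a := ∀ x, G x ⬝ᵥ P.corner b = 0 → F x ⬝ᵥ P.corner a = 0)
            fun h => hco ⟨a, h⟩, mul_zero, sub_zero, mul_one]
          exact ind_congr (by simp only [and_comm])
        · rintro a x ⟨hx, hb⟩ h0
          -- The slice is open only within a plane, so the perturbation must use a direction of that
          -- plane. Such a direction exists exactly because the pair is not degenerate.
          have : ∃ d, G d ⬝ᵥ P.corner b = 0 ∧ F d ⬝ᵥ P.corner a ≠ 0 := by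
            by_contra! hc
            exact hco ⟨a, hc⟩
          obtain ⟨d, hd, hd'⟩ := this
          have hz : ∀ e : ℝ, G (x + e • d) ⬝ᵥ P.corner b = 0 := by
            intro e
            rw [map_add, map_smul, add_dotProduct, smul_dotProduct, hd, hb.out, smul_zero, add_zero]
          obtain ⟨⟨e, he, he'⟩, e', h, h'⟩ :=
            exists_pos_neg_of_isOpen hO hx (dotForm F (P.corner a)) h0 hd'
          exact ⟨⟨_, ⟨he, hz e⟩, he'⟩, _, ⟨h, hz e'⟩, h'⟩
    · rw [ind_false hne, zero_add, Finset.sum_eq_zero, Finset.sum_eq_zero]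
      · intro a _
        rw [ind_false, zero_mul]
        rintro ⟨x, hx, -, h⟩
        exact hne ⟨x, hx, h⟩
      · intro a _
        apply ind_false
        rintro ⟨x, hx, -, h⟩
        exact hne ⟨x, hx, h⟩
  have hr := P.sum_down_eq_of_isOpen hC hO G j hG hG'
  have h1 := Finset.sum_congr (rfl : (Finset.univ : Finset (Fin p)) = Finset.univ)
    fun a _ => row a
  have h2 := Finset.sum_congr (rfl : (Finset.univ : Finset (Fin p)) = Finset.univ)
    fun b _ => col b
  rw [Finset.sum_add_distrib] at h1 h2
  rw [Finset.sum_comm] at h2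
  rw [Finset.sum_comm (f := fun b a => ind (∃ x ∈ C, F x ⬝ᵥ P.corner a = 0 ∧ G x ⬝ᵥ P.corner b = 0)
    * (1 - 2 * ind (∀ x, G x ⬝ᵥ P.corner b = 0 → F x ⬝ᵥ P.corner a = 0)))] at h2
  linarith

end ConvexPolygon

/-! ### Words, their cells, and the second difference of their number -/

lemma sum_cons {α : Type*} [Fintype α] {n : ℕ} (f : (Fin (n + 1) → α) → ℤ) :
    ∑ s, f s = ∑ w : Fin n → α, ∑ a, f (Fin.cons a w) := by
  rw [← Equiv.sum_comp (Fin.consEquiv fun _ => α), Fintype.sum_prod_type, Finset.sum_comm]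
  rfl

lemma sum_snoc {α : Type*} [Fintype α] {n : ℕ} (f : (Fin (n + 1) → α) → ℤ) :
    ∑ s, f s = ∑ w : Fin n → α, ∑ b, f (Fin.snoc w b) := by
  rw [← Equiv.sum_comp (Fin.snocEquiv fun _ => α), Fintype.sum_prod_type, Finset.sum_comm]
  rfl

namespace ConvexPolygon

variable {κ : ℝ} {p : ℕ} [NeZero p] (P : ConvexPolygon κ p)

/-- The vector normal to the `i`-th side. -/
def sideNormal (i : Fin p) : Fin 3 → ℝ := ![κ * P.sideForm i 0, P.sideForm i 1, P.sideForm i 2]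

/-- The squared length of the normal vector. -/
def sideNorm (i : Fin p) : ℝ :=
  κ * P.sideForm i 0 ^ 2 + P.sideForm i 1 ^ 2 + P.sideForm i 2 ^ 2

lemma sideForm_dot_sideNormal (i : Fin p) : P.sideForm i ⬝ᵥ P.sideNormal i = P.sideNorm i := by
  simp [sideNormal, sideNorm, dotProduct, Fin.sum_univ_three]
  ring

/-- The negative of the reflection about the `i`-th side, acting on linear forms. -/
def reflectFormFun (i : Fin p) (l : Fin 3 → ℝ) : Fin 3 → ℝ :=
  -l + (2 * (l ⬝ᵥ P.sideNormal i) / P.sideNorm i) • P.sideForm i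

lemma reflectFormFun_involutive (i : Fin p) : Function.Involutive (P.reflectFormFun i) := by
  intro l
  simp only [reflectFormFun, add_dotProduct, neg_dotProduct, smul_dotProduct,
    sideForm_dot_sideNormal, smul_eq_mul]
  rw [neg_add, neg_neg, add_assoc, ← neg_smul, ← add_smul]
  by_cases h : P.sideNorm i = 0
  · simp [h]
  · field_simp
    ring_nf
    simp

/-- The negative of the reflection about the `i`-th side, acting on linear forms: it takes the form
of a chord ending on the `i`-th side to the form of the next chord. -/
def reflectForm (i : Fin p) : (Fin 3 → ℝ) ≃ₗ[ℝ] (Fin 3 → ℝ) :=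
  LinearEquiv.ofInvolutive
    { toFun := P.reflectFormFun i
      map_add' := fun x y => by
        simp only [reflectFormFun, add_dotProduct, mul_add, add_div, add_smul, neg_add]
        abel
      map_smul' := fun c x => by
        simp only [reflectFormFun, smul_dotProduct, smul_eq_mul, RingHom.id_apply, smul_add,
          smul_neg, smul_smul]
        congr 2
        ring }
    (P.reflectFormFun_involutive i)

lemma reflectForm_apply (i : Fin p) (l : Fin 3 → ℝ) :
    P.reflectForm i l = -l + (2 * (l ⬝ᵥ P.sideNormal i) / P.sideNorm i) • P.sideForm i := rfl

lemma reflectForm_reflectForm (i : Fin p) (l : Fin 3 → ℝ) :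
    P.reflectForm i (P.reflectForm i l) = l := P.reflectFormFun_involutive i l

lemma reflectForm_dot_of_sideForm (i : Fin p) (l : Fin 3 → ℝ) {x : Fin 3 → ℝ}
    (hx : P.sideForm i ⬝ᵥ x = 0) : P.reflectForm i l ⬝ᵥ x = -(l ⬝ᵥ x) := by
  rw [reflectForm_apply, add_dotProduct, smul_dotProduct, hx, neg_dotProduct, smul_zero, add_zero]

lemma reflectForm_corner (i : Fin p) (l : Fin 3 → ℝ) :
    P.reflectForm i l ⬝ᵥ P.corner i = -(l ⬝ᵥ P.corner i) :=
  P.reflectForm_dot_of_sideForm i l (P.sideForm_corner_self i)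

lemma reflectForm_corner_succ (i : Fin p) (l : Fin 3 → ℝ) :
    P.reflectForm i l ⬝ᵥ P.corner (i + 1) = -(l ⬝ᵥ P.corner (i + 1)) :=
  P.reflectForm_dot_of_sideForm i l (P.sideForm_corner_succ i)

lemma down_reflectForm {i : Fin p} {l : Fin 3 → ℝ} :
    P.Down i (P.reflectForm i l) ↔ l ⬝ᵥ P.corner i < 0 ∧ 0 < l ⬝ᵥ P.corner (i + 1) := by
  rw [Down, reflectForm_corner, reflectForm_corner_succ, neg_pos, neg_lt_zero]

lemma half_reflectForm {i : Fin p} {l : Fin 3 → ℝ} :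
    P.Half i (P.reflectForm i l) ↔ l ⬝ᵥ P.corner i ≤ 0 ∧ 0 < l ⬝ᵥ P.corner (i + 1) := by
  rw [Half, reflectForm_corner, reflectForm_corner_succ, neg_nonneg, neg_lt_zero]

lemma up_of_down_reflect {i : Fin p} {l : Fin 3 → ℝ} (h : P.Down i l) :
    P.reflectForm i l ⬝ᵥ P.corner i < 0 ∧ 0 < P.reflectForm i l ⬝ᵥ P.corner (i + 1) := by
  rwa [← down_reflectForm, reflectForm_reflectForm]

/-- The form of the `k`-th chord of an orbit with the word `s`, in terms of the form of the first
chord. The last of these forms belongs to the chord following the orbit. -/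
def evol {n : ℕ} (s : Fin (n + 1) → Fin p) (k : Fin (n + 1)) : (Fin 3 → ℝ) ≃ₗ[ℝ] (Fin 3 → ℝ) :=
  Fin.induction (motive := fun _ => (Fin 3 → ℝ) ≃ₗ[ℝ] (Fin 3 → ℝ)) (LinearEquiv.refl ℝ _)
    (fun k M => M.trans (P.reflectForm (s k.succ))) k

lemma evol_zero {n : ℕ} (s : Fin (n + 1) → Fin p) (l : Fin 3 → ℝ) : P.evol s 0 l = l := rfl

lemma evol_succ {n : ℕ} (s : Fin (n + 1) → Fin p) (k : Fin n) (l : Fin 3 → ℝ) :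
    P.evol s k.succ l = P.reflectForm (s k.succ) (P.evol s k.castSucc l) := rfl

/-- `evol` does not reflect in the first letter of its word. Prepending a letter therefore inserts
exactly the reflection in the former first side. -/
lemma evol_cons {n : ℕ} (a : Fin p) (w : Fin (n + 1) → Fin p) (k : Fin (n + 1))
    (l : Fin 3 → ℝ) :
    P.evol (Fin.cons a w : Fin (n + 2) → Fin p) k.succ l = P.evol w k (P.reflectForm (w 0) l) := by
  induction k using Fin.induction with
  | zero => rfl
  | succ k ih =>
    rw [evol_succ, evol_succ, Fin.cons_succ, ← ih]
    rfl

lemma evol_snoc_castSucc {n : ℕ} (b : Fin p) (w : Fin (n + 1) → Fin p) (k : Fin (n + 1))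
    (l : Fin 3 → ℝ) :
    P.evol (Fin.snoc w b : Fin (n + 2) → Fin p) k.castSucc l = P.evol w k l := by
  induction k using Fin.induction with
  | zero => rfl
  | succ k ih =>
    rw [evol_succ, ← Fin.succ_castSucc, evol_succ, ih, Fin.succ_castSucc,
      Fin.snoc_castSucc (α := fun _ => Fin p)]

lemma evol_snoc_last {n : ℕ} (b : Fin p) (w : Fin (n + 1) → Fin p) (l : Fin 3 → ℝ) :
    P.evol (Fin.snoc w b : Fin (n + 2) → Fin p) (Fin.last (n + 1)) l =
      P.reflectForm b (P.evol w (Fin.last n) l) := by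
  rw [← Fin.succ_last, evol_succ, evol_snoc_castSucc, Fin.succ_last,
    Fin.snoc_last (α := fun _ => Fin p)]

/-- The forms of the first chords of the regular orbits with the word `s`. -/
def cell {n : ℕ} (s : Fin (n + 1) → Fin p) : Set (Fin 3 → ℝ) :=
  {l | ∀ k, P.Down (s k) (P.evol s k l)}

lemma cell_eq_iInter {n : ℕ} (s : Fin (n + 1) → Fin p) :
    P.cell s = ⋂ k, {l | P.Down (s k) ((P.evol s k).toLinearMap l)} := by
  ext l
  simp [cell]

lemma convex_cell {n : ℕ} (s : Fin (n + 1) → Fin p) : Convex ℝ (P.cell s) := by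
  rw [cell_eq_iInter]
  exact convex_iInter fun k => P.convex_down _ _

lemma isOpen_cell {n : ℕ} (s : Fin (n + 1) → Fin p) : IsOpen (P.cell s) := by
  rw [cell_eq_iInter]
  exact isOpen_iInter_of_finite fun k => P.isOpen_down _ _

lemma mem_cell_cons {n : ℕ} {a : Fin p} {w : Fin (n + 1) → Fin p} {l : Fin 3 → ℝ} :
    l ∈ P.cell (Fin.cons a w : Fin (n + 2) → Fin p) ↔
      P.Down a l ∧ P.reflectForm (w 0) l ∈ P.cell w := by
  simp only [cell, Set.mem_ofPred_eq]
  rw [Fin.forall_fin_succ]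
  simp only [Fin.cons_succ, evol_cons, Fin.cons_zero, evol_zero]

lemma mem_cell_snoc {n : ℕ} {b : Fin p} {w : Fin (n + 1) → Fin p} {l : Fin 3 → ℝ} :
    l ∈ P.cell (Fin.snoc w b : Fin (n + 2) → Fin p) ↔
      l ∈ P.cell w ∧ P.Down b (P.reflectForm b (P.evol w (Fin.last n) l)) := by
  simp only [cell, Set.mem_ofPred_eq]
  rw [Fin.forall_fin_succ']
  simp only [evol_snoc_castSucc, evol_snoc_last, Fin.snoc_castSucc (α := fun _ => Fin p),
    Fin.snoc_last (α := fun _ => Fin p)]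

lemma cell_cons_nonempty {n : ℕ} {a : Fin p} {w : Fin (n + 1) → Fin p} :
    (P.cell (Fin.cons a w : Fin (n + 2) → Fin p)).Nonempty ↔
      ∃ x ∈ P.cell w, P.Down a (P.reflectForm (w 0) x) := by
  constructor
  · rintro ⟨l, hl⟩
    rw [mem_cell_cons] at hl
    exact ⟨_, hl.2, by rw [reflectForm_reflectForm]; exact hl.1⟩
  · rintro ⟨x, hx, hd⟩
    exact ⟨_, (P.mem_cell_cons).2 ⟨hd, by rwa [reflectForm_reflectForm]⟩⟩

/-- The negative of the form of the chord following an orbit with the word `w`. -/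
def backForm {n : ℕ} (w : Fin (n + 1) → Fin p) : (Fin 3 → ℝ) →ₗ[ℝ] (Fin 3 → ℝ) :=
  -(P.evol w (Fin.last n)).toLinearMap

lemma backForm_apply {n : ℕ} (w : Fin (n + 1) → Fin p) (l : Fin 3 → ℝ) :
    P.backForm w l = -P.evol w (Fin.last n) l := rfl

lemma down_reflectForm_evol {n : ℕ} {w : Fin (n + 1) → Fin p} {b : Fin p} {l : Fin 3 → ℝ} :
    P.Down b (P.reflectForm b (P.evol w (Fin.last n) l)) ↔ P.Down b (P.backForm w l) := by
  rw [down_reflectForm, Down, backForm_apply, neg_dotProduct, neg_dotProduct, neg_pos, neg_lt_zero]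

lemma exists_dot_corner_ne (M : (Fin 3 → ℝ) ≃ₗ[ℝ] (Fin 3 → ℝ)) (a : Fin p) :
    ∃ d, M d ⬝ᵥ P.corner a ≠ 0 := by
  refine ⟨M.symm (P.sideForm (a + 1)), ?_⟩
  rw [LinearEquiv.apply_symm_apply]
  refine (P.sideForm_corner_pos ?_ ?_).ne'
  · exact (P.add_one_ne a).symm
  · exact (P.add_two_ne a).symm

/-- The forms of the first chords of the orbits with the word `s` that begin and end in corners and
are regular in between. -/
def diagCell {n : ℕ} (s : Fin (n + 1) → Fin p) : Set (Fin 3 → ℝ) :=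
  {l | (∀ k, P.Half (s k) (P.evol s k l)) ∧
    (∀ k, k ≠ 0 → k ≠ Fin.last n → 0 < P.evol s k l ⬝ᵥ P.corner (s k)) ∧
    l ⬝ᵥ P.corner (s 0) = 0 ∧ P.evol s (Fin.last n) l ⬝ᵥ P.corner (s (Fin.last n)) = 0}

/-- The unfolded first and last corners of the word `s` lie in the same line through the origin. -/
def Conjugate {n : ℕ} (s : Fin (n + 1) → Fin p) : Prop :=
  ∀ l, P.evol s (Fin.last n) l ⬝ᵥ P.corner (s (Fin.last n)) = 0 → l ⬝ᵥ P.corner (s 0) = 0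

lemma reflectForm_up {n : ℕ} {w : Fin (n + 1) → Fin p} {x : Fin 3 → ℝ} (hx : x ∈ P.cell w) :
    P.reflectForm (w 0) x ⬝ᵥ P.corner (w 0) < 0 ∧
      0 < P.reflectForm (w 0) x ⬝ᵥ P.corner (w 0 + 1) :=
  P.up_of_down_reflect (hx 0)

lemma backForm_up {n : ℕ} {w : Fin (n + 1) → Fin p} {x : Fin 3 → ℝ} (hx : x ∈ P.cell w) :
    P.backForm w x ⬝ᵥ P.corner (w (Fin.last n)) < 0 ∧
      0 < P.backForm w x ⬝ᵥ P.corner (w (Fin.last n) + 1) := by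
  rw [backForm_apply, neg_dotProduct, neg_dotProduct, neg_lt_zero, neg_pos]
  exact hx (Fin.last n)

/-- After a zero at a corner, a form that goes up at side $i$ must be negative at the next corner.
So for extensions of a regular word, the sign conditions at the two extreme corners are automatic.
-/
lemma half_of_up {f : Fin 3 → ℝ} {i a : Fin p}
    (hf : f ⬝ᵥ P.corner i < 0 ∧ 0 < f ⬝ᵥ P.corner (i + 1)) (ha : f ⬝ᵥ P.corner a = 0) :
    P.Half a f := by
  refine ⟨ha.ge, P.form_neg_succ hf.1 hf.2 ?_ ha.le⟩
  rintro rfl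
  exact hf.1.ne ha

lemma evol_cons_snoc_last {n : ℕ} {a b : Fin p} {w : Fin (n + 1) → Fin p} {l : Fin 3 → ℝ} :
    P.evol (Fin.cons a (Fin.snoc w b : Fin (n + 2) → Fin p) : Fin (n + 3) → Fin p)
      (Fin.last (n + 2)) l
      = P.reflectForm b (P.evol w (Fin.last n) (P.reflectForm (w 0) l)) := by
  rw [← Fin.succ_last, evol_cons, evol_snoc_last]
  rfl

lemma mem_diagCell {n : ℕ} {a b : Fin p} {w : Fin (n + 1) → Fin p} {l : Fin 3 → ℝ} :
    l ∈ P.diagCell (Fin.cons a (Fin.snoc w b : Fin (n + 2) → Fin p) : Fin (n + 3) → Fin p) ↔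
      P.reflectForm (w 0) l ∈ P.cell w ∧ l ⬝ᵥ P.corner a = 0 ∧
        P.backForm w (P.reflectForm (w 0) l) ⬝ᵥ P.corner b = 0 := by
  have hb : ∀ x, P.backForm w x ⬝ᵥ P.corner b =
      P.reflectForm b (P.evol w (Fin.last n) x) ⬝ᵥ P.corner b := by
    intro x
    rw [reflectForm_corner, backForm_apply, neg_dotProduct]
  have hs : (Fin.cons a (Fin.snoc w b : Fin (n + 2) → Fin p) : Fin (n + 3) → Fin p)
      (Fin.last (n + 2)) = b := by
    rw [← Fin.succ_last, Fin.cons_succ, Fin.snoc_last (α := fun _ => Fin p)]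
  have hmid : ∀ k : Fin (n + 1), P.evol (Fin.cons a (Fin.snoc w b : Fin (n + 2) → Fin p) :
      Fin (n + 3) → Fin p) k.castSucc.succ l = P.evol w k (P.reflectForm (w 0) l) := by
    intro k
    rw [evol_cons, evol_snoc_castSucc]
    rfl
  have hmid' : ∀ k : Fin (n + 1), (Fin.cons a (Fin.snoc w b : Fin (n + 2) → Fin p) :
      Fin (n + 3) → Fin p) k.castSucc.succ = w k := by
    intro k
    rw [Fin.cons_succ, Fin.snoc_castSucc (α := fun _ => Fin p)]
  simp only [diagCell, Set.mem_ofPred_eq, hs, evol_cons_snoc_last, Fin.cons_zero]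
  rw [hb]
  constructor
  · rintro ⟨h1, h2, h3, h4⟩
    refine ⟨fun k => ?_, h3, h4⟩
    have e1 := h1 k.castSucc.succ
    have e2 := h2 k.castSucc.succ (Fin.succ_ne_zero _)
      (by rw [← Fin.succ_last, Ne, Fin.succ_inj]; exact (Fin.castSucc_lt_last k).ne)
    rw [hmid, hmid'] at e1 e2
    exact ⟨e2, e1.2⟩
  · rintro ⟨h1, h3, h4⟩
    have hup := P.reflectForm_up h1
    rw [reflectForm_reflectForm] at hup
    have ha := P.half_of_up hup h3
    have hbb := P.half_of_up (P.backForm_up h1) (a := b) (by rw [hb]; exact h4)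
    have hbb' : P.Half b (P.reflectForm b (P.evol w (Fin.last n) (P.reflectForm (w 0) l))) := by
      rw [half_reflectForm]
      rw [Half, backForm_apply, neg_dotProduct, neg_dotProduct, neg_nonneg, neg_lt_zero] at hbb
      exact hbb
    have cases : ∀ k : Fin (n + 3), k = 0 ∨ k = Fin.last (n + 2) ∨
        ∃ j : Fin (n + 1), k = j.castSucc.succ := by
      intro k
      rcases Fin.eq_zero_or_eq_succ k with h | ⟨j, rfl⟩
      · exact Or.inl h
      · rcases Fin.eq_castSucc_or_eq_last j with ⟨i, rfl⟩ | rfl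
        · exact Or.inr (Or.inr ⟨i, rfl⟩)
        · exact Or.inr (Or.inl (Fin.succ_last _))
    refine ⟨fun k => ?_, fun k hk hk' => ?_, h3, h4⟩
    · rcases cases k with rfl | rfl | ⟨j, rfl⟩
      · exact ha
      · rw [hs, evol_cons_snoc_last]
        exact hbb'
      · rw [hmid, hmid']
        exact (h1 j).half
    · rcases cases k with rfl | rfl | ⟨j, rfl⟩
      · exact absurd rfl hk
      · exact absurd rfl hk'
      · rw [hmid, hmid']
        exact (h1 j).1

lemma diagCell_nonempty {n : ℕ} {a b : Fin p} {w : Fin (n + 1) → Fin p} :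
    (P.diagCell (Fin.cons a (Fin.snoc w b : Fin (n + 2) → Fin p) : Fin (n + 3) → Fin p)).Nonempty ↔
      ∃ x ∈ P.cell w, P.reflectForm (w 0) x ⬝ᵥ P.corner a = 0 ∧
        P.backForm w x ⬝ᵥ P.corner b = 0 := by
  constructor
  · rintro ⟨l, hl⟩
    rw [mem_diagCell] at hl
    exact ⟨_, hl.1, by rw [reflectForm_reflectForm]; exact hl.2.1, hl.2.2⟩
  · rintro ⟨x, hx, h1, h2⟩
    exact ⟨P.reflectForm (w 0) x, (P.mem_diagCell).2
      (by rw [reflectForm_reflectForm]; exact ⟨hx, h1, h2⟩)⟩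

lemma conjugate_iff {n : ℕ} {a b : Fin p} {w : Fin (n + 1) → Fin p} :
    P.Conjugate (Fin.cons a (Fin.snoc w b : Fin (n + 2) → Fin p) : Fin (n + 3) → Fin p) ↔
      ∀ x, P.backForm w x ⬝ᵥ P.corner b = 0 → P.reflectForm (w 0) x ⬝ᵥ P.corner a = 0 := by
  have hs : (Fin.cons a (Fin.snoc w b : Fin (n + 2) → Fin p) : Fin (n + 3) → Fin p)
      (Fin.last (n + 2)) = b := by
    rw [← Fin.succ_last, Fin.cons_succ, Fin.snoc_last (α := fun _ => Fin p)]
  simp only [Conjugate, hs, evol_cons_snoc_last, Fin.cons_zero, reflectForm_corner, backForm_apply,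
    neg_dotProduct]
  constructor
  · intro h x hx
    refine h (P.reflectForm (w 0) x) ?_
    rw [reflectForm_reflectForm]
    exact hx
  · intro h l hl
    have := h _ hl
    rwa [reflectForm_reflectForm] at this

/-- The words of length `n + 1` of the regular orbits. -/
def cellWords (n : ℕ) : Set (Fin (n + 1) → Fin p) := {s | (P.cell s).Nonempty}

/-- The second difference of the number of words. -/
lemma cellWords_second_difference (n : ℕ) :
    ((P.cellWords (n + 2)).ncard : ℤ) - 2 * (P.cellWords (n + 1)).ncard + (P.cellWords n).ncard =
      ∑ s : Fin (n + 3) → Fin p, ind (P.diagCell s).Nonempty * (1 - 2 * ind (P.Conjugate s)) := by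
  have e2 : ((P.cellWords (n + 2)).ncard : ℤ) = ∑ w : Fin (n + 1) → Fin p, ∑ a, ∑ b,
      ind (∃ x ∈ P.cell w, P.Down a (P.reflectForm (w 0) x) ∧ P.Down b (P.backForm w x)) := by
    rw [ncard_eq_sum_ind, sum_cons, sum_snoc]
    refine Finset.sum_congr rfl fun w _ => ?_
    rw [Finset.sum_comm]
    refine Finset.sum_congr rfl fun a _ => Finset.sum_congr rfl fun b _ => ind_congr ?_
    refine (P.cell_cons_nonempty).trans (exists_congr fun x => ?_)
    rw [mem_cell_snoc, down_reflectForm_evol, and_assoc]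
    exact and_congr_right fun _ => and_comm
  have e1 : ((P.cellWords (n + 1)).ncard : ℤ) = ∑ w : Fin (n + 1) → Fin p, ∑ a,
      ind (∃ x ∈ P.cell w, P.Down a (P.reflectForm (w 0) x)) := by
    rw [ncard_eq_sum_ind, sum_cons]
    exact Finset.sum_congr rfl fun w _ => Finset.sum_congr rfl fun a _ =>
      ind_congr P.cell_cons_nonempty
  have e1' : ((P.cellWords (n + 1)).ncard : ℤ) = ∑ w : Fin (n + 1) → Fin p, ∑ b,
      ind (∃ x ∈ P.cell w, P.Down b (P.backForm w x)) := by
    rw [ncard_eq_sum_ind, sum_snoc]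
    refine Finset.sum_congr rfl fun w _ => Finset.sum_congr rfl fun b _ =>
      ind_congr (exists_congr fun x => ?_)
    rw [mem_cell_snoc, down_reflectForm_evol]
  have e0 : ((P.cellWords n).ncard : ℤ) = ∑ w : Fin (n + 1) → Fin p, ind (P.cell w).Nonempty :=
    ncard_eq_sum_ind _
  have er : ∑ s : Fin (n + 3) → Fin p, ind (P.diagCell s).Nonempty * (1 - 2 * ind (P.Conjugate s))
      = ∑ w : Fin (n + 1) → Fin p, ∑ a, ∑ b,
        ind (∃ x ∈ P.cell w, P.reflectForm (w 0) x ⬝ᵥ P.corner a = 0 ∧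
          P.backForm w x ⬝ᵥ P.corner b = 0) *
        (1 - 2 * ind (∀ x, P.backForm w x ⬝ᵥ P.corner b = 0 →
          P.reflectForm (w 0) x ⬝ᵥ P.corner a = 0)) := by
    rw [sum_cons, sum_snoc]
    refine Finset.sum_congr rfl fun w _ => ?_
    rw [Finset.sum_comm]
    refine Finset.sum_congr rfl fun a _ => Finset.sum_congr rfl fun b _ => ?_
    rw [ind_congr P.diagCell_nonempty, ind_congr P.conjugate_iff]
  -- Since `reflectForm` is an involution, the same map recovers the form of the preceding chord.
  -- The sign in `backForm` makes the forward continuation, too, cross its known side upwards.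
  have hw := fun w : Fin (n + 1) → Fin p => P.bilateral_count (P.convex_cell w) (P.isOpen_cell w)
    (P.reflectForm (w 0)).toLinearMap (P.backForm w) (w 0) (w (Fin.last n))
    (fun x hx => P.reflectForm_up hx) (fun x hx => P.backForm_up hx)
    (fun b => (P.exists_dot_corner_ne (P.evol w (Fin.last n)) b).imp fun d hd => by
      rwa [backForm_apply, neg_dotProduct, neg_ne_zero])
  have hsum := Finset.sum_congr (rfl : (Finset.univ : Finset (Fin (n + 1) → Fin p)) = Finset.univ)
    fun w _ => hw w
  simp only [LinearEquiv.coe_coe] at hsum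
  rw [← er, Finset.sum_add_distrib, Finset.sum_sub_distrib, Finset.sum_sub_distrib, ← e2, ← e1,
    ← e1', ← e0] at hsum
  linarith

end ConvexPolygon

/-! ### Geometry of the surface, of points on sides, and of chords -/

/-- The quadratic form defining the surface. -/
def quadForm (κ : ℝ) (x : Fin 3 → ℝ) : ℝ := x 0 ^ 2 + κ * (x 1 ^ 2 + x 2 ^ 2)

/-- The polar form of the quadratic form defining the surface. -/
def polarForm (κ : ℝ) (x y : Fin 3 → ℝ) : ℝ := x 0 * y 0 + κ * (x 1 * y 1 + x 2 * y 2)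

lemma mem_surface {κ : ℝ} {x : Fin 3 → ℝ} :
    x ∈ Surface κ ↔ quadForm κ x = 1 ∧ (κ ≤ 0 → 0 < x 0) := Iff.rfl

lemma quadForm_smul (κ c : ℝ) (x : Fin 3 → ℝ) : quadForm κ (c • x) = c ^ 2 * quadForm κ x := by
  simp [quadForm]
  ring

lemma quadForm_add (κ s t : ℝ) (x y : Fin 3 → ℝ) : quadForm κ (s • x + t • y) =
    s ^ 2 * quadForm κ x + t ^ 2 * quadForm κ y + 2 * (s * t) * polarForm κ x y := by
  simp [quadForm, polarForm]
  ring

lemma eq_one_of_smul_mem_surface {κ c : ℝ} {x : Fin 3 → ℝ} (hx : x ∈ Surface κ)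
    (hc : 0 < c) (h : c • x ∈ Surface κ) : c = 1 := by
  have h1 := (mem_surface.1 h).1
  rw [quadForm_smul, (mem_surface.1 hx).1] at h1
  nlinarith

/-- This is the reverse Cauchy–Schwarz phenomenon: two points of the same sheet have positive
Lorentzian product. It later shows that reflections do not exchange the sheets. -/
lemma polarForm_pos {κ : ℝ} (hκ : κ ≤ 0) {x y : Fin 3 → ℝ} (hx : x ∈ Surface κ)
    (hy : y ∈ Surface κ) : 0 < polarForm κ x y := by
  obtain ⟨hx1, hx0⟩ := hx
  obtain ⟨hy1, hy0⟩ := hy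
  have hxy := mul_pos (hx0 hκ) (hy0 hκ)
  by_contra! h
  rw [polarForm] at h
  have h2 : (x 0 * y 0) ^ 2 ≤ (-κ * (x 1 * y 1 + x 2 * y 2)) ^ 2 :=
    pow_le_pow_left₀ hxy.le (by linarith) 2
  have e : (x 0 * y 0) ^ 2 = (1 - κ * (x 1 ^ 2 + x 2 ^ 2)) * (1 - κ * (y 1 ^ 2 + y 2 ^ 2)) := by
    rw [mul_pow, ← eq_sub_of_add_eq hx1, ← eq_sub_of_add_eq hy1]
  rw [e] at h2
  have a1 : 0 ≤ -κ * (x 1 ^ 2 + x 2 ^ 2) := mul_nonneg (by linarith) (by positivity)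
  have a2 : 0 ≤ -κ * (y 1 ^ 2 + y 2 ^ 2) := mul_nonneg (by linarith) (by positivity)
  have a3 : 0 ≤ κ ^ 2 * (x 1 * y 2 - x 2 * y 1) ^ 2 := by positivity
  nlinarith

lemma surface_ne_zero {κ : ℝ} {x : Fin 3 → ℝ} (hx : x ∈ Surface κ) : x ≠ 0 := by
  rintro rfl
  have := hx.1
  simp at this

lemma dot_self_pos {x : Fin 3 → ℝ} (hx : x ≠ 0) : 0 < x ⬝ᵥ x :=
  lt_of_le_of_ne (Finset.sum_nonneg fun _ _ => mul_self_nonneg _)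
    (Ne.symm (mt dotProduct_self_eq_zero.1 hx))

lemma exists_smul_of_cross_eq_zero {l m : Fin 3 → ℝ} (hl : l ≠ 0) (h : l ⨯₃ m = 0) :
    ∃ t : ℝ, m = t • l := by
  have h0 := dot_self_pos hl
  refine ⟨(m ⬝ᵥ l) / (l ⬝ᵥ l), ?_⟩
  rw [div_eq_inv_mul, mul_smul, ← smul_eq_smul_of_cross_eq_zero h l, smul_smul,
    inv_mul_cancel₀ h0.ne', one_smul]

lemma dot_smul_cross (n m b e : Fin 3 → ℝ) : (n ⬝ᵥ m) • (b ⨯₃ e) =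
    ((b ⨯₃ e) ⬝ᵥ m) • n + (n ⬝ᵥ e) • (b ⨯₃ m) + (n ⬝ᵥ b) • (m ⨯₃ e) := by
  ext i
  fin_cases i <;> simp [dotProduct, Fin.sum_univ_three, cross_apply, Matrix.vecHead,
    Matrix.vecTail] <;> ring

lemma cross_cross_eq (l b e : Fin 3 → ℝ) :
    l ⨯₃ (b ⨯₃ e) = (l ⬝ᵥ e) • b - (l ⬝ᵥ b) • e := by
  ext i
  fin_cases i <;> simp [dotProduct, Fin.sum_univ_three, cross_apply] <;> ring

namespace ConvexPolygon

variable {κ : ℝ} {p : ℕ} [NeZero p] (P : ConvexPolygon κ p)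

lemma corner_ne_zero (i : Fin p) : P.corner i ≠ 0 := surface_ne_zero (P.corner_mem i)

lemma corner_coeff_unique {i : Fin p} {a b a' b' : ℝ}
    (h : a • P.corner i + b • P.corner (i + 1) = a' • P.corner i + b' • P.corner (i + 1)) :
    a = a' ∧ b = b' := by
  have hpos := P.sideForm_corner_pos (P.add_one_ne i).symm (P.add_two_ne i).symm
  have ha : a = a' := by
    have := congrArg (P.sideForm (i + 1) ⬝ᵥ ·) h
    simp only [dotProduct_add, dotProduct_smul, sideForm_corner_self, mul_zero, add_zero,
      smul_eq_mul] at this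
    exact mul_right_cancel₀ hpos.ne' this
  subst ha
  exact ⟨rfl, smul_left_injective ℝ (P.corner_ne_zero (i + 1)) (add_left_cancel h)⟩

/-- The points of the `i`-th side apart from its second corner. -/
def halfSide (i : Fin p) : Set (Fin 3 → ℝ) := P.side i \ {P.corner (i + 1)}

lemma openSide_subset_halfSide (i : Fin p) : P.openSide i ⊆ P.halfSide i :=
  fun _ hx => ⟨hx.1, fun h => hx.2 (Or.inr h)⟩

variable {P}

lemma sideForm_of_mem_side {i : Fin p} {x : Fin 3 → ℝ} (hx : x ∈ P.side i) :
    P.sideForm i ⬝ᵥ x = 0 := by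
  obtain ⟨-, s, t, -, -, rfl⟩ := hx
  simp [dotProduct_add, sideForm_corner_self, sideForm_corner_succ]

lemma sideForm_nonneg_of_mem_side {i : Fin p} {x : Fin 3 → ℝ} (hx : x ∈ P.side i) (j : Fin p) :
    0 ≤ P.sideForm j ⬝ᵥ x := by
  obtain ⟨-, s, t, hs, ht, rfl⟩ := hx
  rw [dotProduct_add, dotProduct_smul, dotProduct_smul]
  exact add_nonneg (mul_nonneg hs (P.sideForm_corner_nonneg j _))
    (mul_nonneg ht (P.sideForm_corner_nonneg j _))

lemma exists_of_mem_halfSide {i : Fin p} {x : Fin 3 → ℝ} (hx : x ∈ P.halfSide i) :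
    ∃ s t : ℝ, 0 < s ∧ 0 ≤ t ∧ x = s • P.corner i + t • P.corner (i + 1) := by
  obtain ⟨⟨hS, s, t, hs, ht, rfl⟩, hne⟩ := hx
  refine ⟨s, t, lt_of_le_of_ne hs ?_, ht, rfl⟩
  rintro rfl
  rw [zero_smul, zero_add] at hne hS
  rcases ht.lt_or_eq with h | rfl
  · rw [eq_one_of_smul_mem_surface (P.corner_mem _) h hS, one_smul] at hne
    exact hne rfl
  · rw [zero_smul] at hS
    exact surface_ne_zero hS rfl

lemma exists_of_mem_openSide {i : Fin p} {x : Fin 3 → ℝ} (hx : x ∈ P.openSide i) :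
    ∃ s t : ℝ, 0 < s ∧ 0 < t ∧ x = s • P.corner i + t • P.corner (i + 1) := by
  obtain ⟨s, t, hs, ht, rfl⟩ := exists_of_mem_halfSide (P.openSide_subset_halfSide i hx)
  refine ⟨s, t, hs, lt_of_le_of_ne ht ?_, rfl⟩
  rintro rfl
  obtain ⟨⟨hS, -⟩, hne⟩ := hx
  rw [zero_smul, add_zero] at hne hS
  rw [eq_one_of_smul_mem_surface (P.corner_mem _) hs hS, one_smul] at hne
  exact hne (Or.inl rfl)

lemma mem_halfSide_of_eq {i : Fin p} {x : Fin 3 → ℝ} (hx : x ∈ Surface κ) {s t : ℝ} (hs : 0 < s)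
    (ht : 0 ≤ t) (h : x = s • P.corner i + t • P.corner (i + 1)) : x ∈ P.halfSide i := by
  refine ⟨⟨hx, s, t, hs.le, ht, h⟩, fun hc => ?_⟩
  have := P.corner_coeff_unique (a' := 0) (b' := 1) (h.symm.trans (by simpa using hc))
  exact hs.ne' this.1

lemma eq_corner_or_mem_openSide {i : Fin p} {x : Fin 3 → ℝ} (hx : x ∈ P.halfSide i) :
    x = P.corner i ∨ x ∈ P.openSide i := by
  by_cases h : x = P.corner i
  · exact Or.inl h
  · refine Or.inr ⟨hx.1, ?_⟩
    rintro (h' | h')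
    · exact h h'
    · exact hx.2 h'

variable (P) in
lemma corner_mem_halfSide (i : Fin p) : P.corner i ∈ P.halfSide i :=
  mem_halfSide_of_eq (P.corner_mem i) one_pos le_rfl (by simp)

/-- Assigning each corner only to the side that it begins makes the half-open sides a partition of
the boundary. Orbits with end points in corners thus have a unique word as well. -/
lemma eq_of_mem_halfSide {i j : Fin p} {x : Fin 3 → ℝ} (hi : x ∈ P.halfSide i)
    (hj : x ∈ P.halfSide j) : i = j := by
  have key : ∀ {i j : Fin p}, x ∈ P.halfSide i → x ∈ P.halfSide j → i = j ∨ i = j + 1 := by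
    intro i j hi hj
    obtain ⟨s, t, hs, ht, h⟩ := exists_of_mem_halfSide hi
    have h0 := sideForm_of_mem_side hj.1
    rw [h, dotProduct_add, dotProduct_smul, dotProduct_smul, smul_eq_mul, smul_eq_mul] at h0
    have h1 := mul_nonneg ht (P.sideForm_corner_nonneg j (i + 1))
    have h2 := mul_nonneg hs.le (P.sideForm_corner_nonneg j i)
    refine P.eq_or_eq_of_sideForm_corner ?_
    have h3 : s * P.sideForm j ⬝ᵥ P.corner i = 0 := by linarith
    exact (mul_eq_zero.1 h3).resolve_left hs.ne'
  rcases key hi hj with h | h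
  · exact h
  rcases key hj hi with h' | h'
  · exact h'.symm
  · rw [h] at h'
    exact absurd h'.symm (P.add_two_ne j)

lemma eq_of_mem_openSide {i j : Fin p} {x : Fin 3 → ℝ} (hi : x ∈ P.openSide i)
    (hj : P.sideForm j ⬝ᵥ x = 0) : i = j := by
  by_contra hij
  obtain ⟨s, t, hs, ht, rfl⟩ := exists_of_mem_openSide hi
  rw [dotProduct_add, dotProduct_smul, dotProduct_smul, smul_eq_mul, smul_eq_mul] at hj
  have h1 := mul_nonneg ht.le (P.sideForm_corner_nonneg j (i + 1))
  have h2 := mul_nonneg hs.le (P.sideForm_corner_nonneg j i)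
  rcases P.sideForm_corner_add_pos hij with h | h
  · linarith [mul_pos hs h]
  · linarith [mul_pos ht h]

lemma sideForm_pos_or_eq {i j : Fin p} {x : Fin 3 → ℝ} (hx : x ∈ P.halfSide i) (hij : i ≠ j) :
    0 < P.sideForm j ⬝ᵥ x ∨ (x = P.corner i ∧ i = j + 1) := by
  rcases eq_corner_or_mem_openSide hx with h | h
  · by_cases hi : i = j + 1
    · exact Or.inr ⟨h, hi⟩
    · rw [h]
      exact Or.inl (P.sideForm_corner_pos hij hi)
  · refine Or.inl (lt_of_le_of_ne (sideForm_nonneg_of_mem_side hx.1 j) fun h0 => ?_)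
    exact hij (eq_of_mem_openSide h h0.symm)

lemma exists_halfSide_of_mem_boundary {x : Fin 3 → ℝ} (hx : x ∈ P.boundary) :
    ∃ i, x ∈ P.halfSide i := by
  obtain ⟨i, hi⟩ := Set.mem_iUnion.1 hx
  by_cases h : x = P.corner (i + 1)
  · exact ⟨i + 1, h ▸ P.corner_mem_halfSide (i + 1)⟩
  · exact ⟨i, hi, h⟩

lemma mem_boundary_of_mem_side {i : Fin p} {x : Fin 3 → ℝ} (hx : x ∈ P.side i) :
    x ∈ P.boundary := Set.mem_iUnion.2 ⟨i, hx⟩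

lemma geodSegment_comm (κ : ℝ) (b e : Fin 3 → ℝ) : geodSegment κ b e = geodSegment κ e b := by
  have key : ∀ b e, geodSegment κ b e ⊆ geodSegment κ e b := by
    rintro b e z ⟨hz, s, t, hs, ht, h⟩
    exact ⟨hz, t, s, ht, hs, by rw [h, add_comm]⟩
  exact (key b e).antisymm (key e b)

lemma IsChord.symm {b e : Fin 3 → ℝ} (h : P.IsChord b e) : P.IsChord e b := by
  obtain ⟨h1, h2, h3, h4⟩ := h
  rw [geodSegment_comm] at h3
  simp only [geodSegment_comm κ b e] at h4
  exact ⟨h2, h1, h3, h4⟩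

lemma geodSegment_subset_side {i : Fin p} {b e : Fin 3 → ℝ} (hb : b ∈ P.side i)
    (he : e ∈ P.side i) : geodSegment κ b e ⊆ P.side i := by
  obtain ⟨-, s, t, hs, ht, rfl⟩ := hb
  obtain ⟨-, s', t', hs', ht', rfl⟩ := he
  rintro z ⟨hz, a, c, ha, hc, rfl⟩
  refine ⟨hz, a * s + c * s', a * t + c * t', by positivity, by positivity, ?_⟩
  module

lemma left_mem_geodSegment {b e : Fin 3 → ℝ} (hb : b ∈ Surface κ) : b ∈ geodSegment κ b e :=
  ⟨hb, 1, 0, zero_le_one, le_rfl, by simp⟩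

lemma right_mem_geodSegment {b e : Fin 3 → ℝ} (he : e ∈ Surface κ) : e ∈ geodSegment κ b e :=
  ⟨he, 0, 1, le_rfl, zero_le_one, by simp⟩

lemma IsChord.sideForm_pos_left {b e : Fin 3 → ℝ} {j : Fin p} (h : P.IsChord b e)
    (he : e ∈ P.openSide j) : 0 < P.sideForm j ⬝ᵥ b := by
  obtain ⟨i, hi⟩ := exists_halfSide_of_mem_boundary h.1
  have hb : b ∉ P.side j := fun hb => h.2.2.2 j (geodSegment_subset_side hb he.1)
  have hij : i ≠ j := by
    rintro rfl
    exact hb hi.1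
  rcases sideForm_pos_or_eq hi hij with h' | ⟨h1, h2⟩
  · exact h'
  · refine absurd ?_ hb
    rw [h1, h2]
    exact ⟨P.corner_mem _, 0, 1, le_rfl, zero_le_one, by simp⟩

lemma sideForm_pos_of_openSide {b e : Fin 3 → ℝ} {i j : Fin p} (hb : b ∈ P.halfSide i)
    (he : e ∈ P.openSide j) (h : 0 < P.sideForm j ⬝ᵥ b) : 0 < P.sideForm i ⬝ᵥ e := by
  refine lt_of_le_of_ne (sideForm_nonneg_of_mem_side he.1 i) fun h0 => ?_
  obtain rfl := eq_of_mem_openSide he h0.symm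
  exact h.ne' (sideForm_of_mem_side hb.1)

lemma IsChord.sideForm_pos {b e : Fin 3 → ℝ} {i j : Fin p} (h : P.IsChord b e)
    (hb : b ∈ P.halfSide i) (he : e ∈ P.halfSide j) (ho : b ∈ P.openSide i ∨ e ∈ P.openSide j) :
    0 < P.sideForm i ⬝ᵥ e ∧ 0 < P.sideForm j ⬝ᵥ b := by
  rcases ho with ho | ho
  · have h1 := h.symm.sideForm_pos_left ho
    exact ⟨h1, sideForm_pos_of_openSide he ho h1⟩
  · have h1 := h.sideForm_pos_left ho
    exact ⟨sideForm_pos_of_openSide hb ho h1, h1⟩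

lemma isChord_of_sideForm_pos {b e : Fin 3 → ℝ} {i j : Fin p} (hb : b ∈ P.halfSide i)
    (he : e ∈ P.halfSide j) (ho : b ∈ P.openSide i ∨ e ∈ P.openSide j)
    (h1 : 0 < P.sideForm i ⬝ᵥ e) (h2 : 0 < P.sideForm j ⬝ᵥ b) : P.IsChord b e := by
  refine ⟨mem_boundary_of_mem_side hb.1, mem_boundary_of_mem_side he.1, ?_, fun k hk => ?_⟩
  · rintro z ⟨hz, s, t, hs, ht, rfl⟩
    refine ⟨hz, fun k => ?_⟩
    change 0 ≤ P.sideForm k ⬝ᵥ _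
    rw [dotProduct_add, dotProduct_smul, dotProduct_smul]
    exact add_nonneg (mul_nonneg hs (sideForm_nonneg_of_mem_side hb.1 k))
      (mul_nonneg ht (sideForm_nonneg_of_mem_side he.1 k))
  · have hkb := sideForm_of_mem_side (hk (left_mem_geodSegment hb.1.1))
    have hke := sideForm_of_mem_side (hk (right_mem_geodSegment he.1.1))
    rcases ho with ho | ho
    · obtain rfl := eq_of_mem_openSide ho hkb
      exact h1.ne' hke
    · obtain rfl := eq_of_mem_openSide ho hke
      exact h2.ne' hkb

lemma half_cross {b e : Fin 3 → ℝ} {i : Fin p} (hb : b ∈ P.halfSide i)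
    (h : 0 < P.sideForm i ⬝ᵥ e) : P.Half i (b ⨯₃ e) := by
  obtain ⟨s, t, hs, ht, rfl⟩ := exists_of_mem_halfSide hb
  have e1 : ((s • P.corner i + t • P.corner (i + 1)) ⨯₃ e) ⬝ᵥ P.corner i
      = t * (P.sideForm i ⬝ᵥ e) := by
    simp [sideForm, dotProduct, Fin.sum_univ_three, cross_apply]
    ring
  have e2 : ((s • P.corner i + t • P.corner (i + 1)) ⨯₃ e) ⬝ᵥ P.corner (i + 1)
      = -(s * (P.sideForm i ⬝ᵥ e)) := by
    simp [sideForm, dotProduct, Fin.sum_univ_three, cross_apply]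
    ring
  rw [Half, e1, e2, neg_lt_zero]
  exact ⟨mul_nonneg ht h.le, mul_pos hs h⟩

lemma up_cross {b e : Fin 3 → ℝ} {j : Fin p} (he : e ∈ P.halfSide j)
    (h : 0 < P.sideForm j ⬝ᵥ b) :
    (b ⨯₃ e) ⬝ᵥ P.corner j ≤ 0 ∧ 0 < (b ⨯₃ e) ⬝ᵥ P.corner (j + 1) := by
  have := half_cross he h
  rw [Half, ← cross_anticomm, neg_dotProduct, neg_dotProduct, neg_nonneg, neg_lt_zero] at this
  exact this

/-- The form vanishing on a chord is determined up to a positive factor. -/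
lemma exists_pos_smul_eq_cross {b e l : Fin 3 → ℝ} {j : Fin p} (he : e ∈ P.halfSide j)
    (h : 0 < P.sideForm j ⬝ᵥ b) (hb0 : l ⬝ᵥ b = 0) (he0 : l ⬝ᵥ e = 0)
    (hl : 0 < l ⬝ᵥ P.corner (j + 1)) : ∃ c : ℝ, 0 < c ∧ b ⨯₃ e = c • l := by
  have h1 := (up_cross he h).2
  have h2 : l ⨯₃ (b ⨯₃ e) = 0 := by rw [cross_cross_eq, hb0, he0, zero_smul, zero_smul, sub_zero]
  have h3 := smul_eq_smul_of_cross_eq_zero h2 (P.corner (j + 1))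
  refine ⟨((b ⨯₃ e) ⬝ᵥ P.corner (j + 1)) / (l ⬝ᵥ P.corner (j + 1)), div_pos h1 hl, ?_⟩
  rw [div_eq_inv_mul, mul_smul, ← h3, smul_smul, inv_mul_cancel₀ hl.ne', one_smul]

/-! ### Reflections in the sides and the reflection law -/

variable (P)

lemma sideForm_ne_zero (i : Fin p) : P.sideForm i ≠ 0 := by
  intro h
  have := P.sideForm_corner_pos (P.add_two_ne i) (P.add_one_ne (i + 1))
  rw [h, zero_dotProduct] at this
  exact this.false

/-- For $\kappa\le0$, the plane of the side meets the sheet in a corner $v$. Cauchy–Schwarz applied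
to $l_0v_0=-(l_1v_1+l_2v_2)$ gives $l_1^2+l_2^2\le v_0^2(\kappa l_0^2+l_1^2+l_2^2)$, and the left
side vanishes only if $l=0$. -/
lemma sideNorm_pos (hκ : κ = 1 ∨ κ ≤ 0) (i : Fin p) : 0 < P.sideNorm i := by
  have hl := P.sideForm_ne_zero i
  have h0 := P.sideForm_corner_self i
  obtain ⟨hv, hv0⟩ := P.corner_mem i
  rw [sideNorm]
  generalize P.sideForm i = l at *
  generalize P.corner i = v at *
  rcases hκ with rfl | hκ
  · have := dot_self_pos hl
    simp [dotProduct, Fin.sum_univ_three] at this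
    nlinarith
  · have hv0 := hv0 hκ
    simp only [dotProduct, Fin.sum_univ_three] at h0
    have cs : (l 0 * v 0) ^ 2 ≤ (l 1 ^ 2 + l 2 ^ 2) * (v 1 ^ 2 + v 2 ^ 2) := by
      have : l 0 * v 0 = -(l 1 * v 1 + l 2 * v 2) := by linarith
      rw [this]
      nlinarith [sq_nonneg (l 1 * v 2 - l 2 * v 1)]
    have h1 : l 1 ^ 2 + l 2 ^ 2 ≤ v 0 ^ 2 * (κ * l 0 ^ 2 + l 1 ^ 2 + l 2 ^ 2) := by
      have h2 := mul_le_mul_of_nonpos_left cs hκ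
      have h3 : v 0 ^ 2 = 1 - κ * (v 1 ^ 2 + v 2 ^ 2) := by linarith
      have h4 : v 0 ^ 2 * (κ * l 0 ^ 2 + l 1 ^ 2 + l 2 ^ 2)
          = κ * (l 0 * v 0) ^ 2 + v 0 ^ 2 * (l 1 ^ 2 + l 2 ^ 2) := by ring
      have h5 : v 0 ^ 2 * (l 1 ^ 2 + l 2 ^ 2) = (l 1 ^ 2 + l 2 ^ 2)
          - κ * ((l 1 ^ 2 + l 2 ^ 2) * (v 1 ^ 2 + v 2 ^ 2)) := by rw [h3]; ring
      linarith
    have h5 : 0 < l 1 ^ 2 + l 2 ^ 2 := by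
      refine lt_of_le_of_ne (by positivity) fun h6 => hl ?_
      have e1 : l 1 = 0 := by nlinarith [sq_nonneg (l 1), sq_nonneg (l 2)]
      have e2 : l 2 = 0 := by nlinarith [sq_nonneg (l 1), sq_nonneg (l 2)]
      have e0 : l 0 = 0 := by
        rw [e1, e2] at h0
        simpa [hv0.ne'] using h0
      ext k
      fin_cases k <;> simp [e0, e1, e2]
    exact pos_of_mul_pos_right (h5.trans_le h1) (by positivity)

lemma sideReflection_apply (i : Fin p) (x : Fin 3 → ℝ) : P.sideReflection i x =
    x - (2 * (P.sideForm i ⬝ᵥ x) / P.sideNorm i) • P.sideNormal i := rfl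

lemma sideReflection_of_sideForm {i : Fin p} {x : Fin 3 → ℝ} (hx : P.sideForm i ⬝ᵥ x = 0) :
    P.sideReflection i x = x := by
  rw [sideReflection_apply, hx, mul_zero, zero_div, zero_smul, sub_zero]

lemma sideReflection_add_smul (i : Fin p) (s t : ℝ) (x y : Fin 3 → ℝ) :
    P.sideReflection i (s • x + t • y) =
      s • P.sideReflection i x + t • P.sideReflection i y := by
  simp only [sideReflection_apply, dotProduct_add, dotProduct_smul, smul_eq_mul]
  module

variable {P} in
lemma sideForm_sideReflection (hκ : κ = 1 ∨ κ ≤ 0) (i : Fin p) (x : Fin 3 → ℝ) :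
    P.sideForm i ⬝ᵥ P.sideReflection i x = -(P.sideForm i ⬝ᵥ x) := by
  have h := (P.sideNorm_pos hκ i).ne'
  rw [sideReflection_apply, dotProduct_sub, dotProduct_smul, sideForm_dot_sideNormal, smul_eq_mul,
    div_mul_cancel₀ _ h]
  ring

variable {P} in
lemma sideReflection_sideReflection (hκ : κ = 1 ∨ κ ≤ 0) (i : Fin p) (x : Fin 3 → ℝ) :
    P.sideReflection i (P.sideReflection i x) = x := by
  rw [P.sideReflection_apply i (P.sideReflection i x), sideForm_sideReflection hκ,
    sideReflection_apply, mul_neg, neg_div, neg_smul, sub_neg_eq_add, sub_add_cancel]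

variable {P} in
lemma polarForm_sideReflection (hκ : κ = 1 ∨ κ ≤ 0) (i : Fin p) (x y : Fin 3 → ℝ) :
    polarForm κ (P.sideReflection i x) (P.sideReflection i y) = polarForm κ x y := by
  have h := (P.sideNorm_pos hκ i).ne'
  have hn : κ * P.sideForm i 0 ^ 2 + P.sideForm i 1 ^ 2 + P.sideForm i 2 ^ 2 = P.sideNorm i := rfl
  rw [sideReflection_apply, sideReflection_apply]
  generalize hs : 2 * (P.sideForm i ⬝ᵥ x) / P.sideNorm i = s
  generalize ht : 2 * (P.sideForm i ⬝ᵥ y) / P.sideNorm i = t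
  rw [div_eq_iff h] at hs ht
  simp only [sideNormal, polarForm, Pi.sub_apply, Pi.smul_apply, smul_eq_mul, Matrix.cons_val]
  simp only [dotProduct, Fin.sum_univ_three] at hs ht
  linear_combination (κ * s * t) * hn - κ / 2 * t * hs - κ / 2 * s * ht

variable {P} in
lemma sideReflection_mem_surface (hκ : κ = 1 ∨ κ ≤ 0) (i : Fin p) {x : Fin 3 → ℝ}
    (hx : x ∈ Surface κ) : P.sideReflection i x ∈ Surface κ := by
  have hq : ∀ y, quadForm κ y = polarForm κ y y := fun y => by rw [quadForm, polarForm]; ring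
  have h1 : quadForm κ (P.sideReflection i x) = 1 := by
    rw [hq, polarForm_sideReflection hκ, ← hq]
    exact hx.1
  refine mem_surface.2 ⟨h1, fun h0 => ?_⟩
  -- The corner is fixed by the reflection, so its polar product with the image is still positive.
  -- On the opposite sheet that product would be negative.
  have h2 := polarForm_sideReflection (P := P) hκ i x (P.corner i)
  rw [P.sideReflection_of_sideForm (P.sideForm_corner_self i)] at h2
  have h3 := polarForm_pos h0 hx (P.corner_mem i)
  by_contra! hneg
  rcases hneg.lt_or_eq with hneg | hneg
  · have h4 : -P.sideReflection i x ∈ Surface κ := by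
      refine mem_surface.2 ⟨?_, fun _ => by simpa using hneg⟩
      rw [← h1]
      simp [quadForm]
    have h5 := polarForm_pos h0 h4 (P.corner_mem i)
    have h6 : polarForm κ (-P.sideReflection i x) (P.corner i)
        = -polarForm κ (P.sideReflection i x) (P.corner i) := by
      simp [polarForm]
      ring
    linarith
  · rw [quadForm, hneg] at h1
    nlinarith [sq_nonneg (P.sideReflection i x 1), sq_nonneg (P.sideReflection i x 2)]

-- The reflection has determinant $-1$, and cross products transform by the cofactor matrix. This is
-- the source of the minus sign in `reflectForm`.
variable {P} in
lemma cross_sideReflection (hκ : κ = 1 ∨ κ ≤ 0) (i : Fin p) (b e : Fin 3 → ℝ) :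
    P.sideReflection i b ⨯₃ P.sideReflection i e = P.reflectForm i (b ⨯₃ e) := by
  have h := (P.sideNorm_pos hκ i).ne'
  have hk := dot_smul_cross (P.sideForm i) (P.sideNormal i) b e
  rw [sideForm_dot_sideNormal] at hk
  have hb : b ⨯₃ e = (P.sideNorm i)⁻¹ • (P.sideNorm i • (b ⨯₃ e)) := by
    rw [smul_smul, inv_mul_cancel₀ h, one_smul]
  have e1 : P.sideReflection i b ⨯₃ P.sideReflection i e = b ⨯₃ e
      - (2 / P.sideNorm i) • ((P.sideForm i ⬝ᵥ e) • (b ⨯₃ P.sideNormal i)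
        + (P.sideForm i ⬝ᵥ b) • (P.sideNormal i ⨯₃ e)) := by
    simp only [sideReflection_apply, map_sub, LinearMap.sub_apply, map_smul, LinearMap.smul_apply,
      cross_self, smul_zero, sub_zero]
    module
  have e2 : (P.sideForm i ⬝ᵥ e) • (b ⨯₃ P.sideNormal i)
      + (P.sideForm i ⬝ᵥ b) • (P.sideNormal i ⨯₃ e)
      = P.sideNorm i • (b ⨯₃ e) - ((b ⨯₃ e) ⬝ᵥ P.sideNormal i) • P.sideForm i := by
    rw [hk]
    abel
  rw [e1, e2, reflectForm_apply, smul_sub, smul_smul, div_mul_cancel₀ _ h, smul_smul]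
  module

variable {P} in
/-- The reflection law in terms of the linear forms of the two chords. -/
lemma geodLine_eq_image_iff (hκ : κ = 1 ∨ κ ≤ 0) {i : Fin p} {b e e' : Fin 3 → ℝ}
    (he : e ∈ Surface κ) (he' : e' ∈ Surface κ)
    (h0 : P.sideForm i ⬝ᵥ e = 0) (h1 : 0 < P.sideForm i ⬝ᵥ b) (h2 : 0 < P.sideForm i ⬝ᵥ e') :
    geodLine κ e e' = P.sideReflection i '' geodLine κ b e ↔
      ∃ c : ℝ, 0 < c ∧ e ⨯₃ e' = c • P.reflectForm i (b ⨯₃ e) := by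
  have hRe := P.sideReflection_of_sideForm h0
  rw [← cross_sideReflection hκ, hRe]
  constructor
  · intro h
    have hm : e' ∈ geodLine κ e e' := ⟨he', 0, 1, by simp⟩
    rw [h] at hm
    obtain ⟨z, ⟨-, s, t, rfl⟩, hz⟩ := hm
    rw [sideReflection_add_smul, hRe] at hz
    -- Here $e'=s\,Rb+t\,e$ with $R$ the reflection. Both $b$ and $e'$ lie strictly inside while
    -- $Rb$ lies outside, hence $s<0$.
    refine ⟨-s, ?_, ?_⟩
    · rw [← hz, dotProduct_add, dotProduct_smul, dotProduct_smul, h0, sideForm_sideReflection hκ]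
        at h2
      simp only [smul_eq_mul] at h2
      nlinarith
    · rw [← hz, map_add, map_smul, map_smul, cross_self, ← cross_anticomm e]
      module
  · rintro ⟨c, hc, h⟩
    -- Thus $e'=t\,e-c\,Rb$, so $e'$ and $Rb$ span the same plane together with $e$.
    have hz : e ⨯₃ (e' + c • P.sideReflection i b) = 0 := by
      rw [map_add, map_smul, h, ← cross_anticomm e]
      module
    obtain ⟨t, ht⟩ := exists_smul_of_cross_eq_zero (surface_ne_zero he) hz
    have ht' : e' = t • e - c • P.sideReflection i b := by rw [← ht, add_sub_cancel_right]
    ext z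
    constructor
    · rintro ⟨hz, α, β, rfl⟩
      refine ⟨_, ⟨sideReflection_mem_surface hκ i hz, -(β * c), α + β * t, ?_⟩,
        sideReflection_sideReflection hκ i _⟩
      rw [sideReflection_add_smul, hRe, ht', sub_eq_add_neg, ← neg_smul, sideReflection_add_smul,
        sideReflection_sideReflection hκ, hRe]
      module
    · rintro ⟨z, ⟨hz, β, α, rfl⟩, rfl⟩
      refine ⟨sideReflection_mem_surface hκ i hz, α + β * t / c, -(β / c), ?_⟩
      rw [sideReflection_add_smul, hRe, ht', smul_sub, smul_smul, smul_smul]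
      have : -(β / c) * c = -β := by field_simp
      rw [this]
      module

end ConvexPolygon

/-! ### Orbits with a given word as zeros of an evolving form -/

namespace ConvexPolygon

variable {κ : ℝ} {p : ℕ} [NeZero p] {P : ConvexPolygon κ p}

lemma half_smul {c : ℝ} (hc : 0 < c) {i : Fin p} {f : Fin 3 → ℝ} :
    P.Half i (c • f) ↔ P.Half i f := by
  rw [Half, Half, smul_dotProduct, smul_dotProduct, smul_eq_mul, smul_eq_mul,
    mul_nonneg_iff_of_pos_left hc]
  exact and_congr_right fun _ => ⟨fun h => by nlinarith, fun h => by nlinarith⟩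

lemma IsOrbit.mem_boundary {n : ℕ} {q : Fin (n + 2) → (Fin 3 → ℝ)} (h : P.IsOrbit (n + 1) q)
    (k : Fin (n + 2)) : q k ∈ P.boundary := by
  rcases Fin.eq_castSucc_or_eq_last k with ⟨j, rfl⟩ | rfl
  · exact (h.1 j).1
  · exact (h.1 (Fin.last n)).2.1

/-- The forms of the chords between consecutive sides of a sequence of points that is compatible
with the evolution of a linear form. -/
lemma form_of_evol {n : ℕ} {s : Fin (n + 2) → Fin p} {q : Fin (n + 2) → (Fin 3 → ℝ)}
    (hq : ∀ k, q k ∈ P.halfSide (s k)) {l : Fin 3 → ℝ}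
    (hl : ∀ k, P.Half (s k) (P.evol s k l) ∧ P.evol s k l ⬝ᵥ q k = 0) (k : Fin (n + 1)) :
    (0 < P.sideForm (s k.castSucc) ⬝ᵥ q k.succ ∧ 0 < P.sideForm (s k.succ) ⬝ᵥ q k.castSucc) ∧
      P.evol s k.castSucc l ⬝ᵥ q k.succ = 0 ∧
      ∃ c : ℝ, 0 < c ∧ q k.castSucc ⨯₃ q k.succ = c • P.evol s k.castSucc l := by
  have hup : P.evol s k.castSucc l ⬝ᵥ P.corner (s k.succ) ≤ 0 ∧
      0 < P.evol s k.castSucc l ⬝ᵥ P.corner (s k.succ + 1) := by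
    have := (hl k.succ).1
    rwa [evol_succ, half_reflectForm] at this
  have hend : P.evol s k.castSucc l ⬝ᵥ q k.succ = 0 := by
    have := (hl k.succ).2
    rwa [evol_succ, P.reflectForm_dot_of_sideForm _ _ (sideForm_of_mem_side (hq _).1),
      neg_eq_zero] at this
  -- A form cannot leave and reach the same side: its value at the second corner would be both
  -- negative and positive.
  have hne : s k.castSucc ≠ s k.succ := by
    intro hk
    have h1 := hup.2
    rw [← hk] at h1
    exact h1.not_gt (hl k.castSucc).1.2
  have hpos : 0 < P.sideForm (s k.succ) ⬝ᵥ q k.castSucc := by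
    refine (sideForm_pos_or_eq (hq k.castSucc) hne).resolve_right fun ⟨h1, h2⟩ => ?_
    have h3 := (hl k.castSucc).2
    rw [h1, h2] at h3
    exact hup.2.ne' h3
  refine ⟨⟨?_, hpos⟩, hend,
    exists_pos_smul_eq_cross (hq _) hpos (hl k.castSucc).2 hend hup.2⟩
  refine (sideForm_pos_or_eq (hq k.succ) hne.symm).resolve_right fun ⟨h1, h2⟩ => ?_
  have h3 := hend
  rw [h1, h2] at h3
  exact (hl k.castSucc).1.2.ne h3

/-- The orbits through given sides are described by the linear form of their first chord. -/
lemma isOrbit_iff (hκ : κ = 1 ∨ κ ≤ 0) {n : ℕ} {s : Fin (n + 2) → Fin p}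
    {q : Fin (n + 2) → (Fin 3 → ℝ)} (hq : ∀ k, q k ∈ P.halfSide (s k))
    (hint : ∀ k, k ≠ 0 → k ≠ Fin.last (n + 1) → q k ∈ P.openSide (s k))
    (hpair : ∀ k : Fin (n + 1), q k.castSucc ∈ P.openSide (s k.castSucc) ∨
      q k.succ ∈ P.openSide (s k.succ)) :
    P.IsOrbit (n + 1) q ↔ ∃ l, ∀ k, P.Half (s k) (P.evol s k l) ∧ P.evol s k l ⬝ᵥ q k = 0 := by
  constructor
  · intro h
    have hpos := fun k : Fin (n + 1) =>
      (h.1 k).sideForm_pos (hq k.castSucc) (hq k.succ) (hpair k)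
    have hform : ∀ k : Fin (n + 1), ∃ c : ℝ, 0 < c ∧
        q k.castSucc ⨯₃ q k.succ = c • P.evol s k.castSucc (q 0 ⨯₃ q 1) := by
      intro k
      induction k using Fin.induction with
      | zero => exact ⟨1, one_pos, (one_smul _ _).symm⟩
      | succ k ih =>
        obtain ⟨c, hc, ih⟩ := ih
        obtain ⟨-, -, i, hi, hstep⟩ : P.BilliardStep (q k.castSucc.castSucc) (q k.castSucc.succ)
          (q k.succ.succ) := h.2 k.val (by omega)
        obtain rfl := eq_of_mem_halfSide (P.openSide_subset_halfSide i hi) (hq k.castSucc.succ)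
        rw [geodLine_eq_image_iff hκ (hq _).1.1 (hq _).1.1 (sideForm_of_mem_side hi.1)
          (hpos k.castSucc).2 (hpos k.succ).1, ih] at hstep
        obtain ⟨c', hc', hstep⟩ := hstep
        refine ⟨c' * c, mul_pos hc' hc, ?_⟩
        rw [map_smul, smul_smul] at hstep
        exact hstep
    refine ⟨q 0 ⨯₃ q 1, fun k => ?_⟩
    rcases Fin.eq_castSucc_or_eq_last k with ⟨j, rfl⟩ | rfl
    · obtain ⟨c, hc, hj⟩ := hform j
      refine ⟨?_, ?_⟩
      · rw [← half_smul hc, ← hj]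
        exact half_cross (hq _) (hpos j).1
      · have := dot_self_cross (q j.castSucc) (q j.succ)
        rw [hj, dotProduct_smul, smul_eq_mul, mul_eq_zero, or_iff_right hc.ne'] at this
        rwa [dotProduct_comm]
    · obtain ⟨c, hc, hj⟩ := hform (Fin.last n)
      rw [← Fin.succ_last, evol_succ]
      refine ⟨?_, ?_⟩
      · rw [← half_smul hc, ← map_smul, ← hj, half_reflectForm]
        exact up_cross (hq _) (hpos _).2
      · rw [P.reflectForm_dot_of_sideForm _ _ (sideForm_of_mem_side (hq _).1), neg_eq_zero]
        have := dot_cross_self (q (Fin.last n).castSucc) (q (Fin.last n).succ)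
        rw [hj, dotProduct_smul, smul_eq_mul, mul_eq_zero, or_iff_right hc.ne'] at this
        rwa [dotProduct_comm]
  · rintro ⟨l, hl⟩
    have hf := form_of_evol hq hl
    have hchord : ∀ k : Fin (n + 1), P.IsChord (q k.castSucc) (q k.succ) := fun k =>
      isChord_of_sideForm_pos (hq _) (hq _) (hpair k) (hf k).1.1 (hf k).1.2
    refine ⟨hchord, fun i hi => ?_⟩
    have hstep : ∀ k : Fin n, P.BilliardStep (q k.castSucc.castSucc) (q k.castSucc.succ)
        (q k.succ.succ) := by
      intro k
      have ho : q k.castSucc.succ ∈ P.openSide (s k.castSucc.succ) := by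
        refine hint _ (Fin.succ_ne_zero _) ?_
        rw [← Fin.succ_last, Ne, Fin.succ_inj]
        exact (Fin.castSucc_lt_last k).ne
      refine ⟨hchord k.castSucc, hchord k.succ, _, ho, ?_⟩
      rw [geodLine_eq_image_iff hκ (hq _).1.1 (hq _).1.1 (sideForm_of_mem_side ho.1)
          (hf k.castSucc).1.2 (hf k.succ).1.1]
      obtain ⟨c, hc, h1⟩ := (hf k.castSucc).2.2
      obtain ⟨c', hc', h2⟩ := (hf k.succ).2.2
      refine ⟨c' / c, div_pos hc' hc, ?_⟩
      rw [h1, map_smul, smul_smul, div_mul_cancel₀ _ hc.ne']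
      exact h2
    exact hstep ⟨i, by omega⟩

variable (P) in
/-- A vector in the direction of the point at which the form `f` vanishes on the `i`-th side. -/
def crossing (i : Fin p) (f : Fin 3 → ℝ) : Fin 3 → ℝ :=
  (f ⬝ᵥ P.corner i) • P.corner (i + 1) - (f ⬝ᵥ P.corner (i + 1)) • P.corner i

variable (P) in
/-- The point at which the form `f` vanishes on the `i`-th side. -/
def sidePoint (i : Fin p) (f : Fin 3 → ℝ) : Fin 3 → ℝ :=
  (√(quadForm κ (P.crossing i f)))⁻¹ • P.crossing i f

lemma quadForm_combination_pos (hκ : κ = 1 ∨ κ ≤ 0) (i : Fin p) {s t : ℝ} (hs : 0 < s)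
    (ht : 0 ≤ t) : 0 < quadForm κ (s • P.corner i + t • P.corner (i + 1)) := by
  rcases hκ with rfl | hκ
  · have hne : s • P.corner i + t • P.corner (i + 1) ≠ 0 := fun h =>
      hs.ne' (P.corner_coeff_unique (i := i) (a' := 0) (b' := 0) (by simpa using h)).1
    have := dot_self_pos hne
    rw [quadForm]
    simp only [dotProduct, Fin.sum_univ_three] at this
    linarith
  · rw [quadForm_add, (mem_surface.1 (P.corner_mem i)).1, (mem_surface.1 (P.corner_mem (i + 1))).1]
    have := polarForm_pos hκ (P.corner_mem i) (P.corner_mem (i + 1))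
    positivity

lemma crossing_eq (i : Fin p) (f : Fin 3 → ℝ) : P.crossing i f =
    (-(f ⬝ᵥ P.corner (i + 1))) • P.corner i + (f ⬝ᵥ P.corner i) • P.corner (i + 1) := by
  rw [crossing]
  module

lemma quadForm_crossing_pos (hκ : κ = 1 ∨ κ ≤ 0) {i : Fin p} {f : Fin 3 → ℝ} (h : P.Half i f) :
    0 < quadForm κ (P.crossing i f) := by
  rw [crossing_eq]
  exact quadForm_combination_pos hκ i (neg_pos.2 h.2) h.1

lemma sidePoint_mem (hκ : κ = 1 ∨ κ ≤ 0) {i : Fin p} {f : Fin 3 → ℝ} (h : P.Half i f) :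
    P.sidePoint i f ∈ P.halfSide i := by
  have hpos := quadForm_crossing_pos hκ h
  have hr : 0 < (√(quadForm κ (P.crossing i f)))⁻¹ := inv_pos.2 (Real.sqrt_pos.2 hpos)
  have he : P.sidePoint i f = ((√(quadForm κ (P.crossing i f)))⁻¹ * -(f ⬝ᵥ P.corner (i + 1))) •
      P.corner i + ((√(quadForm κ (P.crossing i f)))⁻¹ * (f ⬝ᵥ P.corner i)) •
      P.corner (i + 1) := by
    rw [sidePoint]
    nth_rewrite 2 [crossing_eq]
    rw [smul_add, smul_smul, smul_smul]
  have h1 := mul_pos hr (neg_pos.2 h.2)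
  have h2 := mul_nonneg hr.le h.1
  refine mem_halfSide_of_eq (mem_surface.2 ⟨?_, fun h0 => ?_⟩) h1 h2 he
  · rw [sidePoint, quadForm_smul, inv_pow, Real.sq_sqrt hpos.le, inv_mul_cancel₀ hpos.ne']
  · rw [he]
    have a1 := (mem_surface.1 (P.corner_mem i)).2 h0
    have a2 := (mem_surface.1 (P.corner_mem (i + 1))).2 h0
    exact add_pos_of_pos_of_nonneg (mul_pos h1 a1) (mul_nonneg h2 a2.le)

lemma dot_sidePoint (i : Fin p) (f : Fin 3 → ℝ) : f ⬝ᵥ P.sidePoint i f = 0 := by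
  rw [sidePoint, crossing, dotProduct_smul, dotProduct_sub, dotProduct_smul, dotProduct_smul]
  simp only [smul_eq_mul]
  ring

/-- A crossing form has only one zero on the side. -/
lemma halfSide_zero_unique {i : Fin p} {f x y : Fin 3 → ℝ} (h : P.Half i f)
    (hx : x ∈ P.halfSide i) (hy : y ∈ P.halfSide i) (hfx : f ⬝ᵥ x = 0) (hfy : f ⬝ᵥ y = 0) :
    x = y := by
  obtain ⟨s, t, hs, -, hx'⟩ := exists_of_mem_halfSide hx
  obtain ⟨s', t', hs', -, hy'⟩ := exists_of_mem_halfSide hy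
  rw [hx', dotProduct_add, dotProduct_smul, dotProduct_smul, smul_eq_mul, smul_eq_mul] at hfx
  rw [hy', dotProduct_add, dotProduct_smul, dotProduct_smul, smul_eq_mul, smul_eq_mul] at hfy
  have h3 := h.2.ne
  have htt : t' = s' / s * t := by
    have h1 : s * t' * f ⬝ᵥ P.corner (i + 1) = s' * t * f ⬝ᵥ P.corner (i + 1) := by
      linear_combination s * hfy - s' * hfx
    have := mul_right_cancel₀ h3 h1
    field_simp
    linarith
  have hxy : y = (s' / s) • x := by
    rw [hx', hy', htt, smul_add, smul_smul, smul_smul, div_mul_cancel₀ _ hs.ne']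
  have hS := hy.1.1
  rw [hxy] at hS
  rw [hxy, eq_one_of_smul_mem_surface hx.1.1 (div_pos hs' hs) hS, one_smul]

lemma pos_of_mem_openSide {i : Fin p} {f x : Fin 3 → ℝ} (h : P.Half i f)
    (hx : x ∈ P.openSide i) (hfx : f ⬝ᵥ x = 0) : 0 < f ⬝ᵥ P.corner i := by
  obtain ⟨s, t, hs, ht, rfl⟩ := exists_of_mem_openSide hx
  rw [dotProduct_add, dotProduct_smul, dotProduct_smul, smul_eq_mul, smul_eq_mul] at hfx
  nlinarith [mul_neg_of_pos_of_neg ht h.2]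

lemma mem_openSide_of_pos {i : Fin p} {f x : Fin 3 → ℝ} (h : 0 < f ⬝ᵥ P.corner i)
    (hx : x ∈ P.halfSide i) (hfx : f ⬝ᵥ x = 0) : x ∈ P.openSide i := by
  refine (eq_corner_or_mem_openSide hx).resolve_left ?_
  rintro rfl
  exact h.ne' hfx

lemma sideWords_eq_cellWords (hκ : κ = 1 ∨ κ ≤ 0) (n : ℕ) :
    P.sideWords (n + 1) = P.cellWords (n + 1) := by
  ext s
  constructor
  · rintro ⟨q, hq, hs⟩
    rw [isOrbit_iff hκ (fun k => P.openSide_subset_halfSide _ (hs k)) (fun k _ _ => hs k)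
      (fun k => Or.inl (hs _))] at hq
    obtain ⟨l, hl⟩ := hq
    exact ⟨l, fun k => ⟨pos_of_mem_openSide (hl k).1 (hs k) (hl k).2, (hl k).1.2⟩⟩
  · rintro ⟨l, hl⟩
    have hs : ∀ k, P.sidePoint (s k) (P.evol s k l) ∈ P.openSide (s k) := fun k =>
      mem_openSide_of_pos (hl k).1 (sidePoint_mem hκ (hl k).half) (dot_sidePoint _ _)
    refine ⟨fun k => P.sidePoint (s k) (P.evol s k l), ?_, hs⟩
    rw [isOrbit_iff hκ (fun k => P.openSide_subset_halfSide _ (hs k)) (fun k _ _ => hs k)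
      (fun k => Or.inl (hs _))]
    exact ⟨l, fun k => ⟨(hl k).half, dot_sidePoint _ _⟩⟩

end ConvexPolygon

/-! ### Generalized diagonals with a given word -/

namespace ConvexPolygon

variable {κ : ℝ} {p : ℕ} [NeZero p] {P : ConvexPolygon κ p}

variable (P) in
/-- The points at which the orbit with the word `s` and the first form `l` meets the sides. -/
def path {n : ℕ} (s : Fin (n + 1) → Fin p) (l : Fin 3 → ℝ) (k : Fin (n + 1)) : Fin 3 → ℝ :=
  P.sidePoint (s k) (P.evol s k l)

variable (P) in
/-- The generalized diagonals with the word `s`. -/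
def diagSet {n : ℕ} (s : Fin (n + 1) → Fin p) : Set (Fin (n + 1) → (Fin 3 → ℝ)) :=
  {q | P.IsGenDiag n q ∧ ∀ k, q k ∈ P.halfSide (s k)}

lemma path_mem {n : ℕ} (hκ : κ = 1 ∨ κ ≤ 0) {s : Fin (n + 1) → Fin p} {l : Fin 3 → ℝ}
    (hl : l ∈ P.diagCell s) (k : Fin (n + 1)) : P.path s l k ∈ P.halfSide (s k) :=
  sidePoint_mem hκ (hl.1 k)

lemma evol_dot_path {n : ℕ} (s : Fin (n + 1) → Fin p) (l : Fin 3 → ℝ) (k : Fin (n + 1)) :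
    P.evol s k l ⬝ᵥ P.path s l k = 0 := dot_sidePoint _ _

lemma path_zero {n : ℕ} (hκ : κ = 1 ∨ κ ≤ 0) {s : Fin (n + 1) → Fin p} {l : Fin 3 → ℝ}
    (hl : l ∈ P.diagCell s) : P.path s l 0 = P.corner (s 0) :=
  halfSide_zero_unique (hl.1 0) (path_mem hκ hl 0) (P.corner_mem_halfSide _)
    (evol_dot_path s l 0) hl.2.2.1

lemma path_last {n : ℕ} (hκ : κ = 1 ∨ κ ≤ 0) {s : Fin (n + 1) → Fin p} {l : Fin 3 → ℝ}
    (hl : l ∈ P.diagCell s) : P.path s l (Fin.last n) = P.corner (s (Fin.last n)) :=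
  halfSide_zero_unique (hl.1 _) (path_mem hκ hl _) (P.corner_mem_halfSide _)
    (evol_dot_path s l _) hl.2.2.2

lemma eq_corner_of_mem_range {i : Fin p} {x : Fin 3 → ℝ} (hx : x ∈ P.halfSide i)
    (h : x ∈ Set.range P.corner) : x = P.corner i := by
  obtain ⟨a, rfl⟩ := h
  rw [eq_of_mem_halfSide hx (P.corner_mem_halfSide a)]

lemma castSucc_succ_ne_last {n : ℕ} (k : Fin n) : k.castSucc.succ ≠ Fin.last (n + 1) := by
  rw [← Fin.succ_last, Ne, Fin.succ_inj]
  exact (Fin.castSucc_lt_last k).ne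

lemma IsOrbit.exists_mem_openSide {n : ℕ} {q : Fin (n + 1) → (Fin 3 → ℝ)} (h : P.IsOrbit n q)
    (k : Fin (n + 1)) (h0 : k ≠ 0) (hlast : k ≠ Fin.last n) : ∃ i, q k ∈ P.openSide i := by
  obtain ⟨j, hj⟩ : ∃ j : ℕ, k.val = j + 1 :=
    Nat.exists_eq_succ_of_ne_zero (Fin.val_ne_zero_iff.2 h0)
  have hk : k.val < n := Fin.val_lt_last hlast
  obtain ⟨-, -, i, hi, -⟩ := h.2 j (by omega)
  refine ⟨i, ?_⟩
  have : k = ⟨j + 1, by omega⟩ := Fin.ext hj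
  rwa [this]

/-- With at least two segments, each segment has an end interior to a side. This is what lets
`isOrbit_iff` apply although both extreme points are corners. -/
lemma mem_diagSet_iff (hκ : κ = 1 ∨ κ ≤ 0) {n : ℕ} {s : Fin (n + 3) → Fin p}
    {q : Fin (n + 3) → (Fin 3 → ℝ)} : q ∈ P.diagSet s ↔ ∃ l ∈ P.diagCell s, P.path s l = q := by
  have hpair : ∀ {q : Fin (n + 3) → (Fin 3 → ℝ)},
      (∀ k, k ≠ 0 → k ≠ Fin.last (n + 2) → q k ∈ P.openSide (s k)) →
      ∀ k : Fin (n + 2), q k.castSucc ∈ P.openSide (s k.castSucc) ∨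
        q k.succ ∈ P.openSide (s k.succ) := by
    intro q hint k
    by_cases hk : k = 0
    · subst hk
      exact Or.inr (hint _ (Fin.succ_ne_zero _) (castSucc_succ_ne_last (0 : Fin (n + 1))))
    · exact Or.inl (hint _ (Fin.castSucc_ne_zero_iff.2 hk) (Fin.castSucc_lt_last k).ne)
  constructor
  · rintro ⟨⟨ho, h0, hlast⟩, hq⟩
    have hint : ∀ k, k ≠ 0 → k ≠ Fin.last (n + 2) → q k ∈ P.openSide (s k) := by
      intro k hk hk'
      obtain ⟨i, hi⟩ := ho.exists_mem_openSide k hk hk'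
      rwa [eq_of_mem_halfSide (hq k) (P.openSide_subset_halfSide i hi)]
    rw [isOrbit_iff hκ hq hint (hpair hint)] at ho
    obtain ⟨l, hl⟩ := ho
    have hlc : l ∈ P.diagCell s := by
      refine ⟨fun k => (hl k).1, fun k hk hk' => ?_, ?_, ?_⟩
      · exact pos_of_mem_openSide (hl k).1 (hint k hk hk') (hl k).2
      · rw [← eq_corner_of_mem_range (hq 0) h0]
        exact (hl 0).2
      · rw [← eq_corner_of_mem_range (hq _) hlast]
        exact (hl _).2
    exact ⟨l, hlc, funext fun k => halfSide_zero_unique (hl k).1 (path_mem hκ hlc k) (hq k)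
      (evol_dot_path s l k) (hl k).2⟩
  · rintro ⟨l, hl, rfl⟩
    have hint : ∀ k, k ≠ 0 → k ≠ Fin.last (n + 2) → P.path s l k ∈ P.openSide (s k) :=
      fun k hk hk' => mem_openSide_of_pos (hl.2.1 k hk hk') (path_mem hκ hl k)
        (evol_dot_path s l k)
    refine ⟨⟨?_, ?_, ?_⟩, path_mem hκ hl⟩
    · rw [isOrbit_iff hκ (path_mem hκ hl) hint (hpair hint)]
      exact ⟨l, fun k => ⟨hl.1 k, evol_dot_path s l k⟩⟩
    · rw [path_zero hκ hl]
      exact Set.mem_range_self _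
    · rw [path_last hκ hl]
      exact Set.mem_range_self _

lemma diagSet_nonempty (hκ : κ = 1 ∨ κ ≤ 0) {n : ℕ} {s : Fin (n + 3) → Fin p} :
    (P.diagSet s).Nonempty ↔ (P.diagCell s).Nonempty := by
  constructor
  · rintro ⟨q, hq⟩
    obtain ⟨l, hl, -⟩ := (mem_diagSet_iff hκ).1 hq
    exact ⟨l, hl⟩
  · rintro ⟨l, hl⟩
    exact ⟨_, (mem_diagSet_iff hκ).2 ⟨l, hl, rfl⟩⟩

lemma IsGenDiag.exists_mem_diagSet {n : ℕ} {q : Fin (n + 2) → (Fin 3 → ℝ)}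
    (h : P.IsGenDiag (n + 1) q) : ∃ s, q ∈ P.diagSet s := by
  choose s hs using fun k => exists_halfSide_of_mem_boundary (h.1.mem_boundary k)
  exact ⟨s, h, hs⟩

lemma eq_of_mem_diagSet {n : ℕ} {s s' : Fin (n + 1) → Fin p} {q : Fin (n + 1) → (Fin 3 → ℝ)}
    (h : q ∈ P.diagSet s) (h' : q ∈ P.diagSet s') : s = s' :=
  funext fun k => eq_of_mem_halfSide (h.2 k) (h'.2 k)

lemma smul_mem_diagCell {n : ℕ} {s : Fin (n + 1) → Fin p} {l : Fin 3 → ℝ} {c : ℝ} (hc : 0 < c) :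
    c • l ∈ P.diagCell s ↔ l ∈ P.diagCell s := by
  simp only [diagCell, Set.mem_ofPred_eq, map_smul, half_smul hc, smul_dotProduct, smul_eq_mul,
    mul_pos_iff_of_pos_left hc, mul_eq_zero, hc.ne', false_or]

lemma path_smul (hκ : κ = 1 ∨ κ ≤ 0) {n : ℕ} {s : Fin (n + 1) → Fin p} {l : Fin 3 → ℝ}
    (hl : l ∈ P.diagCell s) {c : ℝ} (hc : 0 < c) : P.path s (c • l) = P.path s l := by
  funext k
  refine halfSide_zero_unique (hl.1 k) (path_mem hκ ((smul_mem_diagCell hc).2 hl) k)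
    (path_mem hκ hl k) ?_ (evol_dot_path s l k)
  have := evol_dot_path (P := P) s (c • l) k
  rwa [map_smul, smul_dotProduct, smul_eq_mul, mul_eq_zero, or_iff_right hc.ne'] at this

/-- A word whose end corners are not conjugate carries at most one generalized diagonal. -/
lemma diagSet_subsingleton (hκ : κ = 1 ∨ κ ≤ 0) {n : ℕ} {s : Fin (n + 3) → Fin p}
    (hs : ¬ P.Conjugate s) : (P.diagSet s).Subsingleton := by
  intro q hq q' hq'
  obtain ⟨l, hl, rfl⟩ := (mem_diagSet_iff hκ).1 hq
  obtain ⟨l', hl', rfl⟩ := (mem_diagSet_iff hκ).1 hq'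
  simp only [Conjugate, not_forall] at hs
  obtain ⟨d, hd, hd'⟩ := hs
  obtain ⟨x, hx⟩ := P.exists_dot_corner_ne (P.evol s (Fin.last _)) (s (Fin.last _))
  -- The forms $l,l',d$ all satisfy the condition at the last corner, which cuts out a plane, so
  -- they are dependent. Only $d$ violates the condition at the first corner, hence $l$ and $l'$ are
  -- already proportional.
  have hdet : (l ⨯₃ l') ⬝ᵥ d = 0 := by
    have key : ((l ⨯₃ l') ⬝ᵥ d) • x = (x ⬝ᵥ (l' ⨯₃ d)) • l + (x ⬝ᵥ (d ⨯₃ l)) • l'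
        + (x ⬝ᵥ (l ⨯₃ l')) • d := by
      ext i
      fin_cases i <;> simp [dotProduct, Fin.sum_univ_three, cross_apply] <;> ring
    have h := congrArg (fun y => P.evol s (Fin.last _) y ⬝ᵥ P.corner (s (Fin.last _))) key
    simp only [map_add, map_smul, add_dotProduct, smul_dotProduct, hl.2.2.2, hl'.2.2.2, hd,
      smul_eq_mul, mul_zero, add_zero, mul_eq_zero, hx, or_false] at h
    exact h
  have hcross : l ⨯₃ l' = 0 := by
    have h := dot_smul_cross (P.corner (s 0)) d l l'
    rw [hdet, dotProduct_comm _ l, dotProduct_comm _ l', hl.2.2.1, hl'.2.2.1, zero_smul, zero_smul,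
      zero_smul, add_zero, add_zero, dotProduct_comm, smul_eq_zero] at h
    exact h.resolve_left hd'
  have h0 := (hl.1 0).2
  have h0' := (hl'.1 0).2
  rw [evol_zero] at h0 h0'
  have hl0 : l ≠ 0 := by
    rintro rfl
    simp at h0
  obtain ⟨t, rfl⟩ := exists_smul_of_cross_eq_zero hl0 hcross
  rw [smul_dotProduct, smul_eq_mul] at h0'
  have ht : 0 < t := by
    by_contra! ht
    nlinarith
  exact (path_smul hκ hl ht).symm

/-- Both end conditions are nonzero linear functionals of the first form. Inclusion of their kernels
therefore means equality. -/
lemma conjugate_symm {n : ℕ} {s : Fin (n + 1) → Fin p} (hs : P.Conjugate s) {l : Fin 3 → ℝ}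
    (hl : l ⬝ᵥ P.corner (s 0) = 0) :
    P.evol s (Fin.last n) l ⬝ᵥ P.corner (s (Fin.last n)) = 0 := by
  obtain ⟨d, hd⟩ := P.exists_dot_corner_ne (LinearEquiv.refl ℝ _) (s 0)
  rw [LinearEquiv.refl_apply] at hd
  set b := P.evol s (Fin.last n) l ⬝ᵥ P.corner (s (Fin.last n)) with hb
  set a := P.evol s (Fin.last n) d ⬝ᵥ P.corner (s (Fin.last n)) with ha
  have h := hs (a • l - b • d) (by
    rw [map_sub, map_smul, map_smul, sub_dotProduct, smul_dotProduct, smul_dotProduct, ← ha, ← hb,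
      smul_eq_mul, smul_eq_mul, mul_comm, sub_self])
  rw [sub_dotProduct, smul_dotProduct, smul_dotProduct, hl, smul_zero, zero_sub, neg_eq_zero,
    smul_eq_mul, mul_eq_zero] at h
  exact h.resolve_right hd

/-- The open conditions defining `diagCell`. -/
def diagCone (P : ConvexPolygon κ p) {n : ℕ} (s : Fin (n + 1) → Fin p) : Set (Fin 3 → ℝ) :=
  (⋂ k, {l | (P.evol s k).toLinearMap l ⬝ᵥ P.corner (s k + 1) < 0}) ∩
    ⋂ k, {l | k ≠ 0 → k ≠ Fin.last n → 0 < (P.evol s k).toLinearMap l ⬝ᵥ P.corner (s k)}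

lemma mem_diagCone {n : ℕ} {s : Fin (n + 1) → Fin p} {l : Fin 3 → ℝ} : l ∈ P.diagCone s ↔
    (∀ k, P.evol s k l ⬝ᵥ P.corner (s k + 1) < 0) ∧
      ∀ k, k ≠ 0 → k ≠ Fin.last n → 0 < P.evol s k l ⬝ᵥ P.corner (s k) := by
  simp [diagCone]

lemma isOpen_diagCone {n : ℕ} (s : Fin (n + 1) → Fin p) : IsOpen (P.diagCone s) := by
  refine (isOpen_iInter_of_finite fun k => isOpen_lt (continuous_dotForm _ _)
    continuous_const).inter (isOpen_iInter_of_finite fun k => ?_)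
  by_cases h : k ≠ 0 ∧ k ≠ Fin.last n
  · simpa [h.1, h.2] using isOpen_lt continuous_const
      (continuous_dotForm (P.evol s k).toLinearMap (P.corner (s k)))
  · convert isOpen_univ
    rw [Set.eq_univ_iff_forall]
    exact fun l h1 h2 => absurd ⟨h1, h2⟩ h

lemma convex_diagCone {n : ℕ} (s : Fin (n + 1) → Fin p) : Convex ℝ (P.diagCone s) := by
  refine (convex_iInter fun k => convex_setOf_dot_neg _ _).inter (convex_iInter fun k => ?_)
  by_cases h : k ≠ 0 ∧ k ≠ Fin.last n
  · simpa [h.1, h.2] using convex_setOf_dot_pos (P.evol s k).toLinearMap (P.corner (s k))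
  · convert convex_univ (𝕜 := ℝ) (E := Fin 3 → ℝ)
    rw [Set.eq_univ_iff_forall]
    exact fun l h1 h2 => absurd ⟨h1, h2⟩ h

lemma mem_diagCell_iff_of_conjugate {n : ℕ} {s : Fin (n + 1) → Fin p} (hs : P.Conjugate s)
    {l : Fin 3 → ℝ} (hl : l ⬝ᵥ P.corner (s 0) = 0) : l ∈ P.diagCell s ↔ l ∈ P.diagCone s := by
  rw [mem_diagCone]
  constructor
  · exact fun h => ⟨fun k => (h.1 k).2, h.2.1⟩
  · rintro ⟨h1, h2⟩
    refine ⟨fun k => ⟨?_, h1 k⟩, h2, hl, conjugate_symm hs hl⟩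
    by_cases h0 : k = 0
    · subst h0
      exact hl.ge
    by_cases hlast : k = Fin.last n
    · subst hlast
      exact (conjugate_symm hs hl).ge
    · exact (h2 k h0 hlast).le

lemma contDiff_evol {n : ℕ} (s : Fin (n + 1) → Fin p) (k : Fin (n + 1)) :
    ContDiff ℝ 1 fun l => P.evol s k l :=
  (LinearMap.toContinuousLinearMap (P.evol s k).toLinearMap).contDiff

lemma contDiff_crossing (i : Fin p) : ContDiff ℝ 1 (P.crossing i) := by
  unfold crossing dotProduct
  fun_prop

lemma contDiffAt_sidePoint (hκ : κ = 1 ∨ κ ≤ 0) {i : Fin p} {f : Fin 3 → ℝ} (h : P.Half i f) :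
    ContDiffAt ℝ 1 (P.sidePoint i) f := by
  have hpos := quadForm_crossing_pos hκ h
  have hq : ContDiff ℝ 1 (quadForm κ) := by
    unfold quadForm
    fun_prop
  have h1 : ContDiffAt ℝ 1 (fun f => quadForm κ (P.crossing i f)) f :=
    (hq.comp (contDiff_crossing i)).contDiffAt
  exact ((h1.sqrt hpos.ne').inv (Real.sqrt_pos.2 hpos).ne').smul (contDiff_crossing i).contDiffAt

lemma exists_eq_Ioo {I : Set ℝ} (hI : Convex ℝ I) (hO : IsOpen I) (hne : I.Nonempty)
    (hb : BddBelow I) (ha : BddAbove I) : ∃ a b, a < b ∧ I = Set.Ioo a b := by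
  have hsub := (hI.isConnected hne).Ioo_csInf_csSup_subset hb ha
  have hsup : I ⊆ Set.Ioo (sInf I) (sSup I) := by
    intro x hx
    obtain ⟨l, u, ⟨hl, hu⟩, hlu⟩ := mem_nhds_iff_exists_Ioo_subset.1 (hO.mem_nhds hx)
    constructor
    · exact (csInf_le hb (hlu ⟨by linarith, by linarith⟩ : (l + x) / 2 ∈ I)).trans_lt (by linarith)
    · exact lt_of_lt_of_le (by linarith)
        (le_csSup ha (hlu ⟨by linarith, by linarith⟩ : (x + u) / 2 ∈ I))
  obtain ⟨x, hx⟩ := hne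
  exact ⟨_, _, (hsup hx).1.trans (hsup hx).2, hsup.antisymm hsub⟩

/-- If the end corners of a word are conjugate, its generalized diagonals form a family. -/
lemma isGenDiagFamily_diagSet (hκ : κ = 1 ∨ κ ≤ 0) {n : ℕ} {s : Fin (n + 3) → Fin p}
    (hs : P.Conjugate s) (hne : (P.diagCell s).Nonempty) :
    P.IsGenDiagFamily (n + 2) (P.diagSet s) := by
  have hup : ∀ l ∈ P.diagCell s, l ⬝ᵥ P.corner (s 1) < 0 ∧ 0 < l ⬝ᵥ P.corner (s 1 + 1) := by
    intro l hl
    have h1 := hl.2.1 (0 : Fin (n + 1)).castSucc.succ (Fin.succ_ne_zero _)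
      (castSucc_succ_ne_last _)
    have h2 := (hl.1 (0 : Fin (n + 1)).castSucc.succ).2
    rw [evol_succ, reflectForm_corner, neg_pos] at h1
    rw [evol_succ, reflectForm_corner_succ, neg_lt_zero] at h2
    exact ⟨h1, h2⟩
  set i := s 1 with hi
  set a := s 0 with ha
  set N := P.sideForm i ⬝ᵥ P.corner a with hN
  have hNpos : 0 < N := by
    obtain ⟨l, hl⟩ := hne
    refine P.sideForm_corner_pos ?_ ?_
    · intro h
      have := hl.2.2.1
      rw [← ha, h] at this
      exact (hup l hl).1.ne this
    · intro h
      have := hl.2.2.1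
      rw [← ha, h] at this
      exact (hup l hl).2.ne' this
  set A := P.corner a ⨯₃ P.corner (i + 1) with hA
  set B := P.corner a ⨯₃ P.corner i with hB
  -- These are the forms vanishing at the initial corner, scaled so that their values at the two
  -- ends of side $i$ differ by $N$. At $t=0$ the form passes through corner $i$, at $t=1$ through
  -- corner $i+1$.
  let line : ℝ →ᵃ[ℝ] (Fin 3 → ℝ) := AffineMap.lineMap B A
  have hline : ∀ t, line t = t • A + (1 - t) • B := fun t => by
    rw [AffineMap.lineMap_apply_module, add_comm]
  have hAa : A ⬝ᵥ P.corner a = 0 := by rw [dotProduct_comm, dot_self_cross]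
  have hBa : B ⬝ᵥ P.corner a = 0 := by rw [dotProduct_comm, dot_self_cross]
  have hAi' : A ⬝ᵥ P.corner (i + 1) = 0 := by rw [dotProduct_comm, dot_cross_self]
  have hBi : B ⬝ᵥ P.corner i = 0 := by rw [dotProduct_comm, dot_cross_self]
  have hAi : A ⬝ᵥ P.corner i = -N := by
    rw [hA, hN, sideForm]
    simp [dotProduct, Fin.sum_univ_three, cross_apply]
    ring
  have hBi' : B ⬝ᵥ P.corner (i + 1) = N := by
    rw [hB, hN, sideForm]
    simp [dotProduct, Fin.sum_univ_three, cross_apply]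
    ring
  have line_a : ∀ t, line t ⬝ᵥ P.corner a = 0 := fun t => by
    rw [hline, add_dotProduct, smul_dotProduct, smul_dotProduct, hAa, hBa, smul_zero, smul_zero,
      add_zero]
  have line_i : ∀ t, line t ⬝ᵥ P.corner i = -(t * N) := fun t => by
    rw [hline, add_dotProduct, smul_dotProduct, smul_dotProduct, hAi, hBi, smul_zero, add_zero,
      smul_eq_mul, mul_neg]
  have line_i' : ∀ t, line t ⬝ᵥ P.corner (i + 1) = (1 - t) * N := fun t => by
    rw [hline, add_dotProduct, smul_dotProduct, smul_dotProduct, hAi', hBi', smul_zero, zero_add,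
      smul_eq_mul]
  have hrep : ∀ l ∈ P.diagCell s, ∃ c t : ℝ, 0 < c ∧ l = c • line t := by
    intro l hl
    obtain ⟨h1, h2⟩ := hup l hl
    have h3 := hl.2.2.1
    rw [← ha] at h3
    set x := l ⬝ᵥ P.corner i with hx
    set y := l ⬝ᵥ P.corner (i + 1) with hy
    have hyx : 0 < y - x := by linarith
    have key : N • l = (-x) • A + y • B := by
      have hgen : N • l = (-x) • A + y • B + (l ⬝ᵥ P.corner a) • P.sideForm i := by
        rw [hN, hx, hy, hA, hB, sideForm]
        ext j
        fin_cases j <;> simp [dotProduct, Fin.sum_univ_three, cross_apply, Matrix.vecHead,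
          Matrix.vecTail] <;> ring
      rw [hgen, h3, zero_smul, add_zero]
    refine ⟨(y - x) / N, -x / (y - x), div_pos hyx hNpos, ?_⟩
    have : l = N⁻¹ • (N • l) := by rw [smul_smul, inv_mul_cancel₀ hNpos.ne', one_smul]
    rw [this, key, hline, smul_add, smul_add, smul_smul, smul_smul, smul_smul, smul_smul]
    congr 2 <;> field_simp
    ring
  -- Conjugacy makes the condition at the final corner automatic on this line. Only open convex
  -- conditions remain, so the admissible parameters form an open interval.
  set I : Set ℝ := line ⁻¹' P.diagCone s with hI
  have hmemI : ∀ t, t ∈ I ↔ line t ∈ P.diagCell s := fun t =>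
    (mem_diagCell_iff_of_conjugate hs (line_a t)).symm
  have hI01 : ∀ t ∈ I, 0 < t ∧ t < 1 := by
    intro t ht
    obtain ⟨h1, h2⟩ := hup _ ((hmemI t).1 ht)
    rw [line_i] at h1
    rw [line_i'] at h2
    constructor
    · nlinarith
    · nlinarith
  have hlinecd : ContDiff ℝ 1 line := by
    have : (line : ℝ → (Fin 3 → ℝ)) = fun t => t • A + (1 - t) • B := funext hline
    rw [this]
    fun_prop
  obtain ⟨α, β, hαβ, hIoo⟩ := exists_eq_Ioo (I := I) ((convex_diagCone s).affine_preimage line)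
    ((isOpen_diagCone s).preimage hlinecd.continuous) (by
      obtain ⟨l, hl⟩ := hne
      obtain ⟨c, t, hc, rfl⟩ := hrep l hl
      exact ⟨t, (hmemI t).2 ((smul_mem_diagCell hc).1 hl)⟩)
    ⟨0, fun t ht => (hI01 t ht).1.le⟩ ⟨1, fun t ht => (hI01 t ht).2.le⟩
  have hpar : ∀ u ∈ Set.Ioo (0 : ℝ) 1, line (α + (β - α) * u) ∈ P.diagCell s := by
    intro u hu
    rw [← hmemI, hIoo]
    constructor <;> nlinarith [hu.1, hu.2]
  refine ⟨fun u => P.path s (line (α + (β - α) * u)), ?_, ?_, ?_, ?_⟩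
  · refine contDiffOn_pi.2 fun k u hu => ContDiffAt.contDiffWithinAt ?_
    have h1 : ContDiff ℝ 1 fun u : ℝ => P.evol s k (line (α + (β - α) * u)) :=
      (contDiff_evol s k).comp (hlinecd.comp (by fun_prop))
    exact ContDiffAt.comp u (contDiffAt_sidePoint hκ ((hpar u hu).1 k)) h1.contDiffAt
  · intro u hu u' hu' h
    -- The first reflection point determines the parameter: at a fixed point of side $i$ the value
    -- of `line t` is a nonconstant affine function of $t$.
    have h1 : ∀ u, line (α + (β - α) * u) ⬝ᵥ P.path s (line (α + (β - α) * u)) 1 = 0 ∨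
        P.path s (line (α + (β - α) * u)) 1 ∉ P.halfSide i := by
      intro u
      by_cases hm : P.path s (line (α + (β - α) * u)) 1 ∈ P.halfSide i
      · left
        have := evol_dot_path (P := P) s (line (α + (β - α) * u)) (0 : Fin (n + 2)).succ
        rw [evol_succ, P.reflectForm_dot_of_sideForm, neg_eq_zero] at this
        · exact this
        · exact sideForm_of_mem_side hm.1
      · exact Or.inr hm
    have hm : P.path s (line (α + (β - α) * u)) 1 ∈ P.halfSide i := path_mem hκ (hpar u hu) 1
    have e1 := (h1 u).resolve_right (not_not.2 hm)
    have e2 := h1 u'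
    rw [← show P.path s (line (α + (β - α) * u)) = P.path s (line (α + (β - α) * u')) from h] at e2
    have e2 := e2.resolve_right (not_not.2 hm)
    obtain ⟨x, y, hx, hy, hxy⟩ := exists_of_mem_halfSide hm
    rw [hxy, dotProduct_add, dotProduct_smul, dotProduct_smul, line_i, line_i', smul_eq_mul,
      smul_eq_mul] at e1 e2
    have h2 : ((β - α) * (x + y) * N) * u = ((β - α) * (x + y) * N) * u' := by linarith
    have h3 : (β - α) * (x + y) * N ≠ 0 :=
      (mul_pos (mul_pos (by linarith) (by linarith)) hNpos).ne'
    exact mul_left_cancel₀ h3 h2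
  · exact fun u hu => ((mem_diagSet_iff hκ).2 ⟨_, hpar u hu, rfl⟩).1
  · ext q
    rw [mem_diagSet_iff hκ]
    constructor
    · rintro ⟨l, hl, rfl⟩
      obtain ⟨c, t, hc, rfl⟩ := hrep l hl
      have ht := (smul_mem_diagCell hc).1 hl
      have ht' := (hmemI t).2 ht
      rw [hIoo] at ht'
      have hba : 0 < β - α := by linarith
      refine ⟨(t - α) / (β - α), ⟨div_pos (by linarith [ht'.1]) hba,
        (div_lt_one hba).2 (by linarith [ht'.2])⟩, ?_⟩
      have e : α + (β - α) * ((t - α) / (β - α)) = t := by field_simp; ring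
      simp only [e]
      exact (path_smul hκ ht hc).symm
    · rintro ⟨u, hu, rfl⟩
      exact ⟨_, hpar u hu, rfl⟩

end ConvexPolygon

/-! ### Isolated diagonals and maximal families correspond to words -/

namespace ConvexPolygon

variable {κ : ℝ} {p : ℕ} [NeZero p] {P : ConvexPolygon κ p}

/-- An interior point of a side lies on the geodesic of no other side. The zero sets of the side
forms thus split such a set into disjoint relatively closed pieces. -/
lemma mem_openSide_of_isPreconnected {S : Set (Fin 3 → ℝ)} (hS : IsPreconnected S)
    (hopen : ∀ x ∈ S, ∃ i, x ∈ P.openSide i) {i : Fin p} {x y : Fin 3 → ℝ} (hx : x ∈ S)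
    (hxi : x ∈ P.openSide i) (hy : y ∈ S) : y ∈ P.openSide i := by
  by_contra hyi
  have hcont : ∀ j, Continuous fun z => P.sideForm j ⬝ᵥ z := fun j => by
    unfold dotProduct
    fun_prop
  obtain ⟨z, hz, hz1, hz2⟩ := isPreconnected_closed_iff.1 hS {z | P.sideForm i ⬝ᵥ z = 0}
    (⋃ j ∈ ({i}ᶜ : Set (Fin p)), {z | P.sideForm j ⬝ᵥ z = 0})
    (isClosed_eq (hcont i) continuous_const)
    ((Set.toFinite _).isClosed_biUnion fun j _ => isClosed_eq (hcont j) continuous_const)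
    (by
      intro z hz
      obtain ⟨j, hj⟩ := hopen z hz
      by_cases hji : j = i
      · subst hji
        exact Or.inl (sideForm_of_mem_side hj.1)
      · exact Or.inr (Set.mem_biUnion (show j ∈ ({i}ᶜ : Set (Fin p)) from hji)
          (sideForm_of_mem_side hj.1)))
    ⟨x, hx, sideForm_of_mem_side hxi.1⟩ (by
      obtain ⟨j, hj⟩ := hopen y hy
      refine ⟨y, hy, Set.mem_biUnion (show j ∈ ({i}ᶜ : Set (Fin p)) from ?_)
        (sideForm_of_mem_side hj.1)⟩
      rintro rfl
      exact hyi hj)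
  obtain ⟨j, hji, hzj⟩ := Set.mem_iUnion₂.1 hz2
  obtain ⟨k, hk⟩ := hopen z hz
  exact hji ((eq_of_mem_openSide hk hzj).symm.trans (eq_of_mem_openSide hk hz1))

/-- All the members of a family of generalized diagonals have the same word. -/
lemma IsGenDiagFamily.exists_subset {n : ℕ} {S : Set (Fin (n + 2) → (Fin 3 → ℝ))}
    (hS : P.IsGenDiagFamily (n + 1) S) : ∃ s, S ⊆ P.diagSet s := by
  obtain ⟨γ, hγ, -, hdiag, rfl⟩ := hS
  have hmid : (1 / 2 : ℝ) ∈ Set.Ioo (0 : ℝ) 1 := by constructor <;> norm_num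
  obtain ⟨s, hs⟩ := (hdiag _ hmid).exists_mem_diagSet
  refine ⟨s, ?_⟩
  rintro q ⟨t, ht, rfl⟩
  refine ⟨hdiag t ht, fun k => ?_⟩
  -- The $k$-th points trace a connected set. An end point stays in the finite set of corners and is
  -- constant; an inner point cannot leave its open side.
  have hpre : IsPreconnected ((fun u => γ u k) '' Set.Ioo 0 1) :=
    isPreconnected_Ioo.image _ ((continuous_apply k).comp_continuousOn hγ.continuousOn)
  have corner_case : (∀ u ∈ Set.Ioo (0 : ℝ) 1, γ u k ∈ Set.range P.corner) →
      γ t k ∈ P.halfSide (s k) := by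
    intro h
    have hsub : ((fun u => γ u k) '' Set.Ioo 0 1).Subsingleton :=
      (Set.finite_range P.corner).countable.isTotallyDisconnected _
        (by rintro _ ⟨u, hu, rfl⟩; exact h u hu) hpre
    have := hsub ⟨t, ht, rfl⟩ ⟨_, hmid, rfl⟩
    simp only at this
    rw [this]
    exact hs.2 k
  by_cases h0 : k = 0
  · subst h0
    exact corner_case fun u hu => (hdiag u hu).2.1
  by_cases hlast : k = Fin.last (n + 1)
  · subst hlast
    exact corner_case fun u hu => (hdiag u hu).2.2
  obtain ⟨i, hi⟩ := hs.1.1.exists_mem_openSide k h0 hlast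
  obtain rfl := eq_of_mem_halfSide (hs.2 k) (P.openSide_subset_halfSide i hi)
  refine P.openSide_subset_halfSide _
    (mem_openSide_of_isPreconnected hpre ?_ ⟨_, hmid, rfl⟩ hi ⟨t, ht, rfl⟩)
  rintro _ ⟨u, hu, rfl⟩
  exact (hdiag u hu).1.exists_mem_openSide k h0 hlast

lemma mem_isolatedGenDiags_iff (hκ : κ = 1 ∨ κ ≤ 0) {n : ℕ} {q : Fin (n + 3) → (Fin 3 → ℝ)} :
    q ∈ P.isolatedGenDiags (n + 2) ↔ ∃ s, q ∈ P.diagSet s ∧ ¬ P.Conjugate s := by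
  constructor
  · rintro ⟨hq, hiso⟩
    obtain ⟨s, hs⟩ := hq.exists_mem_diagSet
    exact ⟨s, hs, fun hc => hiso _ (isGenDiagFamily_diagSet hκ hc
      ((diagSet_nonempty hκ).1 ⟨q, hs⟩)) hs⟩
  · rintro ⟨s, hs, hc⟩
    refine ⟨hs.1, fun S hS hqS => ?_⟩
    obtain ⟨s', hs'⟩ := hS.exists_subset
    obtain rfl := eq_of_mem_diagSet hs (hs' hqS)
    obtain ⟨γ, -, hinj, -, rfl⟩ := hS
    have h1 : (1 / 2 : ℝ) ∈ Set.Ioo (0 : ℝ) 1 := by constructor <;> norm_num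
    have h2 : (1 / 3 : ℝ) ∈ Set.Ioo (0 : ℝ) 1 := by constructor <;> norm_num
    have := hinj h1 h2 (diagSet_subsingleton hκ hc (hs' ⟨_, h1, rfl⟩) (hs' ⟨_, h2, rfl⟩))
    norm_num at this

lemma mem_genDiagFamilies_iff (hκ : κ = 1 ∨ κ ≤ 0) {n : ℕ}
    {S : Set (Fin (n + 3) → (Fin 3 → ℝ))} : S ∈ P.genDiagFamilies (n + 2) ↔
      ∃ s, (P.diagCell s).Nonempty ∧ P.Conjugate s ∧ P.diagSet s = S := by
  have hmid : (1 / 2 : ℝ) ∈ Set.Ioo (0 : ℝ) 1 := by constructor <;> norm_num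
  have hne : ∀ {S}, P.IsGenDiagFamily (n + 2) S → S.Nonempty := by
    rintro S ⟨γ, -, -, -, rfl⟩
    exact ⟨_, _, hmid, rfl⟩
  have hconj : ∀ {S s}, P.IsGenDiagFamily (n + 2) S → S ⊆ P.diagSet s → P.Conjugate s := by
    intro S s hS hs
    by_contra hc
    obtain ⟨q, hq⟩ := hne hS
    exact ((mem_isolatedGenDiags_iff hκ).2 ⟨s, hs hq, hc⟩).2 S hS hq
  constructor
  · intro hS
    obtain ⟨s, hs⟩ := hS.prop.exists_subset
    have hcell := (diagSet_nonempty hκ).1 ((hne hS.prop).mono hs)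
    have hc := hconj hS.prop hs
    exact ⟨s, hcell, hc, (hS.eq_of_subset (isGenDiagFamily_diagSet hκ hc hcell) hs).symm⟩
  · rintro ⟨s, hcell, hc, rfl⟩
    refine ⟨isGenDiagFamily_diagSet hκ hc hcell, fun S hS hsub => ?_⟩
    obtain ⟨s', hs'⟩ := hS.exists_subset
    obtain ⟨q, hq⟩ := (diagSet_nonempty hκ).2 hcell
    obtain rfl := eq_of_mem_diagSet hq (hs' (hsub hq))
    exact hs'

/-- Each nonconjugate word with nonempty cell carries exactly one diagonal, and a diagonal has only
one word. Stating this with `encard` also transfers finiteness from the finite set of words. -/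
lemma isolatedGenDiags_encard (hκ : κ = 1 ∨ κ ≤ 0) (n : ℕ) :
    (P.isolatedGenDiags (n + 2)).encard =
      {s : Fin (n + 3) → Fin p | (P.diagCell s).Nonempty ∧ ¬ P.Conjugate s}.encard := by
  choose f hf using fun (s : Fin (n + 3) → Fin p) (h : (P.diagCell s).Nonempty) =>
    (diagSet_nonempty hκ).2 h
  refine (Set.encard_congr (Equiv.ofBijective (fun s => ⟨f s.1 s.2.1,
    (mem_isolatedGenDiags_iff hκ).2 ⟨s.1, hf _ _, s.2.2⟩⟩) ⟨?_, ?_⟩)).symm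
  · intro s s' h
    have h' := Subtype.ext_iff.1 h
    simp only at h'
    have h1 := hf s.1 s.2.1
    rw [h'] at h1
    exact Subtype.ext (eq_of_mem_diagSet h1 (hf s'.1 s'.2.1))
  · rintro ⟨q, hq⟩
    obtain ⟨s, hs, hc⟩ := (mem_isolatedGenDiags_iff hκ).1 hq
    have hcell := (diagSet_nonempty hκ).1 ⟨q, hs⟩
    exact ⟨⟨s, hcell, hc⟩, Subtype.ext (diagSet_subsingleton hκ hc (hf s hcell) hs)⟩

lemma genDiagFamilies_encard (hκ : κ = 1 ∨ κ ≤ 0) (n : ℕ) :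
    (P.genDiagFamilies (n + 2)).encard =
      {s : Fin (n + 3) → Fin p | (P.diagCell s).Nonempty ∧ P.Conjugate s}.encard := by
  have himage : P.genDiagFamilies (n + 2) =
      P.diagSet '' {s : Fin (n + 3) → Fin p | (P.diagCell s).Nonempty ∧ P.Conjugate s} := by
    ext S
    rw [mem_genDiagFamilies_iff hκ]
    simp only [Set.mem_image, Set.mem_ofPred_eq, and_assoc]
  rw [himage, Set.InjOn.encard_image]
  rintro s ⟨hs, -⟩ s' - h
  obtain ⟨q, hq⟩ := (diagSet_nonempty hκ).2 hs
  have hq' := hq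
  rw [h] at hq'
  exact eq_of_mem_diagSet hq hq'

lemma sideComplexity_second_difference (hκ : κ = 1 ∨ κ ≤ 0) (n : ℕ) :
    (P.sideComplexity (n + 3) : ℤ) - 2 * P.sideComplexity (n + 2) + P.sideComplexity (n + 1) =
      (P.isolatedGenDiags (n + 3)).ncard - (P.genDiagFamilies (n + 3)).ncard := by
  rw [sideComplexity, sideComplexity, sideComplexity, sideWords_eq_cellWords hκ,
    sideWords_eq_cellWords hκ, sideWords_eq_cellWords hκ, P.cellWords_second_difference (n + 1),
    Set.ncard, Set.ncard, isolatedGenDiags_encard hκ (n + 1), genDiagFamilies_encard hκ (n + 1),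
    ← Set.ncard, ← Set.ncard, ncard_eq_sum_ind, ncard_eq_sum_ind, ← Finset.sum_sub_distrib]
  refine Finset.sum_congr rfl fun s _ => ?_
  by_cases h1 : (P.diagCell s).Nonempty <;> by_cases h2 : P.Conjugate s <;> simp [ind, h1, h2]

/-! ### Absence of conjugate end corners in nonpositive curvature -/

lemma reflectForm_dot_sideReflection (hκ : κ = 1 ∨ κ ≤ 0) (i : Fin p) (f x : Fin 3 → ℝ) :
    P.reflectForm i f ⬝ᵥ P.sideReflection i x = -(f ⬝ᵥ x) := by
  have h := (P.sideNorm_pos hκ i).ne'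
  rw [reflectForm_apply, add_dotProduct, smul_dotProduct, sideForm_sideReflection hκ,
    sideReflection_apply, neg_dotProduct, dotProduct_sub, dotProduct_smul, smul_eq_mul,
    smul_eq_mul]
  field_simp
  ring

/-- On a line that does not meet itself, "lying before" is transitive. -/
lemma exists_pos_smul_cross_trans {x y z l : Fin 3 → ℝ} (hx : 0 < x 0) (hy : 0 < y 0)
    (hz : 0 < z 0) (hlz : l ⬝ᵥ z = 0) (hxy : ∃ c : ℝ, 0 < c ∧ x ⨯₃ y = c • l)
    (hyz : ∃ c : ℝ, 0 < c ∧ y ⨯₃ z = c • l) : ∃ c : ℝ, 0 < c ∧ x ⨯₃ z = c • l := by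
  obtain ⟨c, hc, hxy⟩ := hxy
  obtain ⟨c', hc', hyz⟩ := hyz
  -- This is addition of oriented lengths in the chart $x_0=1$. The determinant term vanishes
  -- because the three points lie on the plane $l=0$.
  have key : y 0 • (x ⨯₃ z) = x 0 • (y ⨯₃ z) + z 0 • (x ⨯₃ y)
      - ((x ⨯₃ y) ⬝ᵥ z) • ![1, 0, 0] := by
    ext i
    fin_cases i <;> simp [dotProduct, Fin.sum_univ_three, cross_apply] <;> ring
  rw [hxy, hyz, smul_dotProduct, hlz, smul_zero, zero_smul, sub_zero, smul_smul, smul_smul,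
    ← add_smul] at key
  refine ⟨(x 0 * c' + z 0 * c) / y 0, by positivity, ?_⟩
  rw [div_eq_inv_mul, mul_smul, ← key, smul_smul, inv_mul_cancel₀ hy.ne', one_smul]

/-- In nonpositive curvature, the end corners of an unfolded generalized diagonal are distinct. -/
lemma not_conjugate_of_nonpos (h0 : κ ≤ 0) {n : ℕ} {s : Fin (n + 2) → Fin p}
    (hne : (P.diagCell s).Nonempty) : ¬ P.Conjugate s := by
  have hκ : κ = 1 ∨ κ ≤ 0 := Or.inr h0
  obtain ⟨l, hl⟩ := hne
  set q := P.path s l with hq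
  have hqm : ∀ k, q k ∈ P.halfSide (s k) := path_mem hκ hl
  have hf := form_of_evol hqm fun k => ⟨hl.1 k, evol_dot_path s l k⟩
  -- $X$ is the initial corner carried along by the reflections, and $\varepsilon$ absorbs the sign
  -- changes. Positivity of $c$ says that $X$ stays strictly before the current reflection point on
  -- the unfolded geodesic.
  have hstep : ∀ k : Fin (n + 1), ∃ X ∈ Surface κ, (∃ ε : ℝ, ε ≠ 0 ∧
      ∀ m, m ⬝ᵥ P.corner (s 0) = ε * (P.evol s k.succ m ⬝ᵥ X)) ∧
      ∃ c : ℝ, 0 < c ∧ X ⨯₃ q k.succ = c • P.evol s k.succ l := by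
    have advance : ∀ (k : Fin (n + 1)) (X : Fin 3 → ℝ), X ∈ Surface κ → (∃ ε : ℝ, ε ≠ 0 ∧
        ∀ m, m ⬝ᵥ P.corner (s 0) = ε * (P.evol s k.castSucc m ⬝ᵥ X)) →
        (∃ c : ℝ, 0 < c ∧ X ⨯₃ q k.succ = c • P.evol s k.castSucc l) →
        ∃ X ∈ Surface κ, (∃ ε : ℝ, ε ≠ 0 ∧
          ∀ m, m ⬝ᵥ P.corner (s 0) = ε * (P.evol s k.succ m ⬝ᵥ X)) ∧
          ∃ c : ℝ, 0 < c ∧ X ⨯₃ q k.succ = c • P.evol s k.succ l := by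
      rintro k X hX ⟨ε, hε, hm⟩ ⟨c, hc, hcross⟩
      refine ⟨P.sideReflection (s k.succ) X, sideReflection_mem_surface hκ _ hX,
        ⟨-ε, neg_ne_zero.2 hε, fun m => ?_⟩, c, hc, ?_⟩
      · rw [evol_succ, reflectForm_dot_sideReflection hκ, hm, neg_mul_neg]
      · have := cross_sideReflection (P := P) hκ (s k.succ) X (q k.succ)
        rw [P.sideReflection_of_sideForm (sideForm_of_mem_side (hqm k.succ).1)] at this
        rw [this, hcross, map_smul, evol_succ]
    intro k
    induction k using Fin.induction with
    | zero =>
      refine advance 0 (P.corner (s 0)) (P.corner_mem _) ⟨1, one_ne_zero, fun m => ?_⟩ ?_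
      · rw [one_mul]
        rfl
      · have := (hf 0).2.2
        rwa [show q (Fin.castSucc 0) = P.corner (s 0) from path_zero hκ hl] at this
    | succ k ih =>
      obtain ⟨X, hX, hε, hc⟩ := ih
      have h1 := hf k.succ
      exact advance k.succ X hX hε (exists_pos_smul_cross_trans (hX.2 h0)
        ((hqm k.castSucc.succ).1.1.2 h0) ((hqm k.succ.succ).1.1.2 h0) h1.2.1 hc h1.2.2)
  obtain ⟨X, -, ⟨ε, hε, hm⟩, c, hc, hcross⟩ := hstep (Fin.last n)
  rw [Fin.succ_last] at hm hcross
  rw [show q (Fin.last (n + 1)) = P.corner (s (Fin.last (n + 1))) from path_last hκ hl] at hcross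
  intro hconj
  set v := P.corner (s (Fin.last (n + 1))) with hv
  -- The form $v\times(X\times v)$ vanishes at $v$ and takes the value $|X\times v|^2$ at $X$.
  -- Conjugacy would force $X\times v=0$, contrary to the strict order just proved.
  have h1 := hconj ((P.evol s (Fin.last (n + 1))).symm (v ⨯₃ (X ⨯₃ v)))
  rw [LinearEquiv.apply_symm_apply, hm, LinearEquiv.apply_symm_apply] at h1
  have h2 := (mul_eq_zero.1 (h1 (by rw [dotProduct_comm, dot_self_cross]))).resolve_left hε
  have h3 : (v ⨯₃ (X ⨯₃ v)) ⬝ᵥ X = (X ⨯₃ v) ⬝ᵥ (X ⨯₃ v) := by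
    simp [dotProduct, Fin.sum_univ_three, cross_apply]
    ring
  rw [h3, dotProduct_self_eq_zero, hcross] at h2
  have h4 := (smul_eq_zero.1 h2).resolve_left hc.ne'
  have h5 := (hl.1 (Fin.last (n + 1))).2
  rw [h4, zero_dotProduct] at h5
  exact h5.false

lemma genDiagFamilies_eq_empty (h0 : κ ≤ 0) (n : ℕ) : P.genDiagFamilies (n + 2) = ∅ := by
  refine Set.eq_empty_of_forall_notMem fun S hS => ?_
  obtain ⟨s, hne, hc, -⟩ := (mem_genDiagFamilies_iff (Or.inr h0)).1 hS
  exact not_conjugate_of_nonpos h0 hne hc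

lemma isolatedGenDiags_finite (hκ : κ = 1 ∨ κ ≤ 0) (n : ℕ) :
    (P.isolatedGenDiags (n + 2)).Finite := by
  rw [← Set.encard_lt_top_iff, isolatedGenDiags_encard hκ, Set.encard_lt_top_iff]
  exact Set.toFinite _

lemma genDiagFamilies_finite (hκ : κ = 1 ∨ κ ≤ 0) (n : ℕ) :
    (P.genDiagFamilies (n + 2)).Finite := by
  rw [← Set.encard_lt_top_iff, genDiagFamilies_encard hκ, Set.encard_lt_top_iff]
  exact Set.toFinite _

end ConvexPolygon

/-! ### Double summation and conclusion -/

/-- A sequence whose second differences are those of a double sum. -/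
lemma eq_add_mul_add_sum {F g : ℕ → ℤ}
    (h : ∀ n, F (n + 3) - 2 * F (n + 2) + F (n + 1) = g (n + 3)) {n : ℕ} (hn : 1 ≤ n) :
    F n = (2 * F 1 - F 2) + (F 2 - F 1) * n
      + ∑ k ∈ Finset.Icc 3 n, ∑ j ∈ Finset.Icc 3 k, g j := by
  -- The induction carries the first difference along with the value, since the recursion is of
  -- second order.
  have key : ∀ m : ℕ,
      (F (m + 1) = (2 * F 1 - F 2) + (F 2 - F 1) * (m + 1 : ℕ)
        + ∑ k ∈ Finset.Icc 3 (m + 1), ∑ j ∈ Finset.Icc 3 k, g j) ∧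
      F (m + 2) - F (m + 1) = (F 2 - F 1) + ∑ j ∈ Finset.Icc 3 (m + 2), g j := by
    intro m
    induction m with
    | zero =>
      constructor
      · simp
        ring
      · simp
    | succ m ih =>
      obtain ⟨h1, h2⟩ := ih
      have h3 := h m
      constructor
      · rcases m with _ | m
        · simp
          ring
        · rw [Finset.sum_Icc_succ_top (by omega)]
          push_cast at h1 h2 h3 ⊢
          rw [show m + 1 + 1 + 1 = m + 1 + 2 by ring]
          linarith
      · rw [Finset.sum_Icc_succ_top (by omega)]
        rw [show m + 1 + 2 = m + 3 by ring, show m + 1 + 1 = m + 2 by ring]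
        linarith
  obtain ⟨m, rfl⟩ := Nat.exists_eq_add_of_le' hn
  exact (key m).1

end Billiard

end

theorem proposition6 (κ : ℝ) (p : ℕ) [NeZero p] (P : Billiard.ConvexPolygon κ p) :
    (κ = 1 →
      (∀ k, 3 ≤ k → (P.isolatedGenDiags k).Finite ∧ (P.genDiagFamilies k).Finite) ∧
      ∃ c₁ c₂ : ℤ, ∀ n : ℕ, 1 ≤ n →
        (P.sideComplexity n : ℤ) =
          c₁ + c₂ * n + ∑ k ∈ Finset.Icc 3 n, (P.GD k : ℤ) - ∑ k ∈ Finset.Icc 3 n, (P.FGD k : ℤ)) ∧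
    (κ ≤ 0 →
      (∀ k, 3 ≤ k → (P.isolatedGenDiags k).Finite) ∧
      ∃ c₁ c₂ : ℤ, ∀ n : ℕ, 1 ≤ n →
        (P.sideComplexity n : ℤ) =
          c₁ + c₂ * n + ∑ k ∈ Finset.Icc 3 n, (P.GD k : ℤ)) := by
  have main : (κ = 1 ∨ κ ≤ 0) → ∀ n : ℕ, 1 ≤ n → (P.sideComplexity n : ℤ) =
      (2 * P.sideComplexity 1 - P.sideComplexity 2)
        + (P.sideComplexity 2 - P.sideComplexity 1) * n
        + ∑ k ∈ Finset.Icc 3 n, (P.GD k : ℤ) - ∑ k ∈ Finset.Icc 3 n, (P.FGD k : ℤ) := by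
    intro hκ n hn
    have h := Billiard.eq_add_mul_add_sum (F := fun n => (P.sideComplexity n : ℤ))
      (g := fun k => (P.isolatedGenDiags k).ncard - (P.genDiagFamilies k).ncard)
      (fun n => Billiard.ConvexPolygon.sideComplexity_second_difference hκ n) hn
    simp only [Finset.sum_sub_distrib] at h
    simp only [Billiard.ConvexPolygon.GD, Billiard.ConvexPolygon.FGD, Nat.cast_sum]
    rw [h, add_sub_assoc]
  refine ⟨fun hκ => ⟨fun k hk => ?_, _, _, main (Or.inl hκ)⟩,
    fun hκ => ⟨fun k hk => ?_, 2 * P.sideComplexity 1 - P.sideComplexity 2,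
      P.sideComplexity 2 - P.sideComplexity 1, fun n hn => ?_⟩⟩
  · obtain ⟨m, rfl⟩ := Nat.exists_eq_add_of_le' hk
    exact ⟨Billiard.ConvexPolygon.isolatedGenDiags_finite (Or.inl hκ) (m + 1),
      Billiard.ConvexPolygon.genDiagFamilies_finite (Or.inl hκ) (m + 1)⟩
  · obtain ⟨m, rfl⟩ := Nat.exists_eq_add_of_le' hk
    exact Billiard.ConvexPolygon.isolatedGenDiags_finite (Or.inr hκ) (m + 1)
  · have hzero : ∑ k ∈ Finset.Icc 3 n, (P.FGD k : ℤ) = 0 := by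
      refine Finset.sum_eq_zero fun k _ => ?_
      rw [Billiard.ConvexPolygon.FGD, Nat.cast_eq_zero]
      refine Finset.sum_eq_zero fun j hj => ?_
      obtain ⟨m, rfl⟩ := Nat.exists_eq_add_of_le' (Finset.mem_Icc.1 hj).1
      rw [show m + 3 = m + 1 + 2 by ring, Billiard.ConvexPolygon.genDiagFamilies_eq_empty hκ,
        Set.ncard_empty]
    rw [main (Or.inr hκ) n hn, hzero, sub_zero]
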